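/- A finite group $G$ is called \emph{mixable} if there are an integer $k\ge 0$, elements $g_1,\dots,g_k\in G$ and independent Bernoulli random variables $\varepsilon_i\sim\mathrm{Ber}(p_i)$ with $p_i\in[0,1]$ such that the random product $g_1^{\varepsilon_1}\cdots g_k^{\varepsilon_k}$ is exactly uniformly distributed on $G$. A Steiner system $S(t,k,v)$ is a set $X$ of $v$ points with a collection of $k$-element subsets of $X$ (blocks) such that any $t$ distinct points lie in exactly one block; its automorphisms are the permutations of $X$ that preserve the collection of blocks. Let $W_{12}$ and $W_{24}$ be the Witt designs, that is, the (up to isomorphism unique) Steiner systems $S(5,6,12)$ on $\mathbb{F}_{11}\cup\{\infty\}$ and $S(5,8,24)$ on $\mathbb{F}_{23}\cup\{\infty\}$. Deriving them at $\infty$ (keeping the blocks through $\infty$ and removing $\infty$ from each of them) gives Steiner systems $S(4,5,11)$ and $S(4,7,23)$. The Mathieu groups are $$M_{12}=\mathrm{Aut}(S(5,6,12)),\quad M_{11}=\mathrm{Aut}(S(4,5,11)),\quad M_{24}=\mathrm{Aut}(S(5,8,24)),\quad M_{23}=\mathrm{Aut}(S(4,7,23)),$$ and $M_{22}$ is the stabilizer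 of a point in $M_{23}$ (equivalently, the subgroup of index $2$ in $\mathrm{Aut}(S(3,6,22))$). \textbf{Corollary.} The five Mathieu groups $M_{11}$, $M_{12}$, $M_{22}$, $M_{23}$ and $M_{24}$ are mixable. -/

import Mathlib

/-! ### Mixable groups -/

/-- The value of the random subproduct `g₁^ε₁ ⋯ g_k^ε_k` at the outcome `ε`, where `true` stands
for `1` and `false` for `0`. -/
def subproduct {G : Type*} [Group G] {k : ℕ} (g : Fin k → G) (ε : Fin k → Bool) : G :=
  (List.ofFn fun i => g i ^ (ε i).toNat).prod

/-- The probability of the outcome `ε` for independent Bernoulli variables `ε_i ∼ Ber(p_i)`. -/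
def bernoulliWeight {k : ℕ} (p : Fin k → ℝ) (ε : Fin k → Bool) : ℝ :=
  ∏ i, if ε i then p i else 1 - p i

open Classical in
/-- `P(g₁^ε₁ ⋯ g_k^ε_k = x)` for independent `ε_i ∼ Ber(p_i)`. -/
noncomputable def subproductProb {G : Type*} [Group G] {k : ℕ} (g : Fin k → G) (p : Fin k → ℝ)
    (x : G) : ℝ :=
  ∑ ε : Fin k → Bool with subproduct g ε = x, bernoulliWeight p ε

/-- A finite group is mixable if some random subproduct is uniformly distributed on it. -/
def Mixable (G : Type*) [Group G] [Finite G] : Prop :=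
  ∃ (k : ℕ) (g : Fin k → G) (p : Fin k → ℝ),
    (∀ i, 0 ≤ p i ∧ p i ≤ 1) ∧ ∀ x : G, subproductProb g p x = 1 / (Nat.card G : ℝ)

/-! ### Steiner systems and their automorphism groups -/

/-- A Steiner system `S(t, k, v)` on the point set `X`. -/
structure SteinerSystem (t k v : ℕ) (X : Type*) [Fintype X] where
  card_points : Fintype.card X = v
  blocks : Set (Finset X)
  card_block : ∀ B ∈ blocks, B.card = k
  existsUnique_block : ∀ T : Finset X, T.card = t → ∃! B, B ∈ blocks ∧ T ⊆ B

/-- The automorphism group: the permutations of the points that map blocks to blocks and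
non-blocks to non-blocks. -/
def SteinerSystem.aut {t k v : ℕ} {X : Type*} [Fintype X] (S : SteinerSystem t k v X) :
    Subgroup (Equiv.Perm X) where
  carrier := {σ | ∀ B : Finset X, B.map σ.toEmbedding ∈ S.blocks ↔ B ∈ S.blocks}
  one_mem' := by
    intro B
    have : B.map (1 : Equiv.Perm X).toEmbedding = B := Finset.map_refl
    rw [this]
  mul_mem' := by
    intro σ τ hσ hτ B
    have : B.map (σ * τ).toEmbedding = (B.map τ.toEmbedding).map σ.toEmbedding :=
      (Finset.map_map τ.toEmbedding σ.toEmbedding B).symm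
    rw [this, hσ, hτ]
  inv_mem' := by
    intro σ hσ B
    have : (B.map (σ⁻¹ : Equiv.Perm X).toEmbedding).map σ.toEmbedding = B := by
      ext x; simp [Equiv.Perm.inv_def]
    have h := hσ (B.map (σ⁻¹ : Equiv.Perm X).toEmbedding)
    rw [this] at h
    exact h.symm

/-- The derived system at the point `x`: its points are the points other than `x`, and its blocks
are the sets `B \ {x}` for the blocks `B` through `x`. -/
def SteinerSystem.derived {t k v : ℕ} {X : Type*} [Fintype X] [DecidableEq X]
    (S : SteinerSystem (t + 1) (k + 1) (v + 1) X) (x : X) : SteinerSystem t k v {y // y ≠ x} where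
  card_points := by
    have h := S.card_points
    rw [Fintype.card_subtype_compl, Fintype.card_subtype_eq]
    omega
  blocks := {C | insert x (C.map (Function.Embedding.subtype _)) ∈ S.blocks}
  card_block := by
    intro C hC
    have h := S.card_block _ hC
    rw [Finset.card_insert_of_notMem (by simp), Finset.card_map] at h
    omega
  existsUnique_block := by
    intro T hT
    obtain ⟨B, ⟨hB, hTB⟩, hu⟩ := S.existsUnique_block
      (insert x (T.map (Function.Embedding.subtype _)))
      (by rw [Finset.card_insert_of_notMem (by simp), Finset.card_map, hT])
    have hx : x ∈ B := hTB (Finset.mem_insert_self _ _)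
    refine ⟨B.subtype (fun y => y ≠ x), ⟨?_, ?_⟩, ?_⟩
    · have : insert x ((B.subtype (fun y => y ≠ x)).map (Function.Embedding.subtype _)) = B := by
        ext y
        by_cases hy : y = x <;> simp [hy, hx]
      rw [Set.mem_ofPred_eq, this]
      exact hB
    · intro y hy
      rw [Finset.mem_subtype]
      exact hTB (Finset.mem_insert_of_mem (Finset.mem_map_of_mem _ hy))
    · rintro C ⟨hC, hTC⟩
      have := hu (insert x (C.map (Function.Embedding.subtype _)))
        ⟨hC, Finset.insert_subset_insert _ (Finset.map_subset_map.2 hTC)⟩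
      subst this
      ext y
      simp [y.2]

/-! ### The two Witt designs -/

/-- For a prime `p`, the translate by `i` of the set of squares (including `0`) of `ZMod p`, as a
set of points of the projective line `ZMod p ∪ {∞}`, where `none` is the point `∞`. -/
def squareTranslate (p : ℕ) [NeZero p] (i : ZMod p) : Finset (Option (ZMod p)) :=
  Finset.univ.image fun x : ZMod p => some (x ^ 2 + i)

/-- The blocks of `S(5, 6, 12)`. The translates of the squares together with their complements are
22 blocks, and a 6-set is a block if and only if it meets none of those 22 in exactly 5 points. -/
def wittBlocks12 : Set (Finset (Option (ZMod 11))) :=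
  {B | B.card = 6 ∧
    ∀ i, (B ∩ squareTranslate 11 i).card ≠ 1 ∧ (B ∩ squareTranslate 11 i).card ≠ 5}

/-- The blocks of `S(5, 8, 24)`, the octads: the supports of the words of weight 8 of the extended
binary Golay code, that is, of the extended quadratic residue code modulo 23 (which is self-dual,
and spanned by the translates of the squares and the all-ones word). -/
def wittBlocks24 : Set (Finset (Option (ZMod 23))) :=
  {B | B.card = 8 ∧ ∀ i, Even (B ∩ squareTranslate 23 i).card}

namespace Witt12

/-- Numbering of the points. -/
def pt : Fin 12 ≃ Option (ZMod 11) := finSuccEquivLast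

/-- The characteristic number of a set of points. -/
def mask (B : Finset (Option (ZMod 11))) : ℕ := Nat.ofBits fun j : Fin 12 => decide (pt j ∈ B)

/-- The number of ones among the 12 lowest binary digits. -/
def pop (m : ℕ) : ℕ :=
  m % 2 + m / 2 % 2 + m / 4 % 2 + m / 8 % 2 + m / 16 % 2 + m / 32 % 2 + m / 64 % 2 + m / 128 % 2 +
    m / 256 % 2 + m / 512 % 2 + m / 1024 % 2 + m / 2048 % 2

/-- The characteristic numbers of the translates of the squares. -/
def rows : List ℕ := [571, 1142, 237, 474, 948, 1896, 1745, 1443, 839, 1678, 1309]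

/-- The same number, from a table of the values below 64. -/
def fastPop (m : ℕ) : ℕ :=
  Nat.add (Nat.mod (Nat.shiftRight 5266721624626081916652898579601397356032429460333936579656 (Nat.mul 3 (Nat.mod m 64))) 8)
    (Nat.mod (Nat.shiftRight 5266721624626081916652898579601397356032429460333936579656 (Nat.mul 3 (Nat.div m 64))) 8)

/-- Application of a function, written so that the kernel evaluates the argument first. -/
def strict (f : ℕ → Bool) (n : ℕ) : Bool := Nat.rec (f 0) (fun k _ => f (Nat.succ k)) n

theorem strict_eq (f : ℕ → Bool) (n : ℕ) : strict f n = f n := by cases n <;> rfl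

/-- Whether an intersection number is neither 1 nor 5. -/
def admissible (n : ℕ) : Bool := !(Nat.beq n 1) && !(Nat.beq n 5)

/-- Being a block, in terms of characteristic numbers. -/
def hex (m : ℕ) : Bool :=
  Nat.beq (fastPop m) 6 && rows.all fun q => strict admissible (fastPop (Nat.land m q))

theorem fastPop_eq {m : ℕ} (hm : m < 4096) : fastPop m = pop m := by
  have h : ((List.range 4096).all fun n => Nat.beq (fastPop n) (pop n)) = true := by
    decide +kernel
  exact Nat.eq_of_beq_eq_true (List.all_eq_true.1 h m (List.mem_range.2 hm))

theorem testBit_mask (B : Finset (Option (ZMod 11))) (j : Fin 12) :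
    (mask B).testBit j = decide (pt j ∈ B) := by
  simp [mask, Nat.testBit_ofBits_lt]

theorem mask_lt (B : Finset (Option (ZMod 11))) : mask B < 4096 := Nat.ofBits_lt_two_pow _

theorem eq_mask {m : ℕ} (hm : m < 4096) {B : Finset (Option (ZMod 11))}
    (h : ∀ j : Fin 12, m.testBit j = decide (pt j ∈ B)) : m = mask B := by
  apply Nat.eq_of_testBit_eq
  intro i
  by_cases hi : i < 12
  · rw [h ⟨i, hi⟩, ← testBit_mask]
  · have h2 : 2 ^ 12 ≤ 2 ^ i := Nat.pow_le_pow_right (by norm_num) (by omega)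
    rw [Nat.testBit_lt_two_pow (lt_of_lt_of_le hm h2),
      Nat.testBit_lt_two_pow (lt_of_lt_of_le (mask_lt B) h2)]

theorem mask_inter (B C : Finset (Option (ZMod 11))) : mask (B ∩ C) = mask B &&& mask C := by
  symm
  apply eq_mask (lt_of_le_of_lt Nat.and_le_left (mask_lt B))
  intro j
  simp [testBit_mask]

theorem mask_insert (B : Finset (Option (ZMod 11))) (j : Fin 12) :
    mask (insert (pt j) B) = Nat.lor (mask B) (Nat.pow 2 j) := by
  symm
  apply eq_mask
  · apply Nat.or_lt_two_pow (n := 12) (mask_lt B)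
    exact Nat.pow_lt_pow_right (by norm_num) j.2
  intro i
  change (mask B ||| 2 ^ (j : ℕ)).testBit i = _
  rw [Nat.testBit_or, testBit_mask, Nat.testBit_two_pow]
  simp [Fin.ext_iff, eq_comm, Bool.or_comm]

theorem card_eq_pop (B : Finset (Option (ZMod 11))) : B.card = pop (mask B) := by
  have h1 : B.card = ∑ j : Fin 12, if pt j ∈ B then 1 else 0 := by
    rw [Equiv.sum_comp pt (fun x => if x ∈ B then 1 else 0)]
    simp
  have h2 : ∀ j : Fin 12, (if pt j ∈ B then 1 else 0) = mask B / 2 ^ (j : ℕ) % 2 := by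
    intro j
    have := Nat.toNat_testBit (mask B) j
    rw [testBit_mask] at this
    rw [← this]
    by_cases h : pt j ∈ B <;> simp [h]
  rw [h1, Finset.sum_congr rfl fun j _ => h2 j]
  simp [Fin.sum_univ_succ, pop]
  ring

theorem mask_squareTranslate (i : ZMod 11) :
    mask (squareTranslate 11 i) = rows.getD i.val 0 := by
  revert i
  decide +kernel

theorem mem_blocks_iff (B : Finset (Option (ZMod 11))) :
    B ∈ wittBlocks12 ↔ hex (mask B) = true := by
  have h : rows = List.map (fun i : Fin 11 => rows.getD i 0) (List.finRange 11) := by decide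
  have h3 : (∀ i : Fin 11, pop (mask B &&& rows.getD i 0) ≠ 1 ∧ pop (mask B &&& rows.getD i 0) ≠ 5)
      ↔ ∀ q ∈ rows, pop (mask B &&& q) ≠ 1 ∧ pop (mask B &&& q) ≠ 5 := by
    conv_rhs => rw [h]
    simp
  have h2 : B ∈ wittBlocks12 ↔ pop (mask B) = 6 ∧
      ∀ i : Fin 11, pop (mask B &&& rows.getD i 0) ≠ 1 ∧ pop (mask B &&& rows.getD i 0) ≠ 5 := by
    unfold wittBlocks12
    simp only [Set.mem_ofPred_eq, card_eq_pop, mask_inter, mask_squareTranslate]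
    rfl
  rw [h2, h3]
  have h4 : ∀ q, fastPop (Nat.land (mask B) q) = pop (mask B &&& q) := fun q =>
    fastPop_eq (lt_of_le_of_lt Nat.and_le_left (mask_lt B))
  unfold hex
  simp only [strict_eq, h4, fastPop_eq (mask_lt B)]
  simp [admissible, Bool.eq_false_iff]

/-- The positions of the points that complete a set of points to a block. -/
def completions (m : ℕ) : List ℕ :=
  (List.range 12).filter fun j => !Nat.testBit m j && strict hex (Nat.lor m (Nat.pow 2 j))

theorem check : ∀ m < 4096, pop m = 5 → (completions m).length = 1 := by
  have h : ((List.range 4096).all fun m =>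
      !Nat.beq (fastPop m) 5 || Nat.beq (completions m).length 1) = true := by
    decide +kernel
  intro m hm h5
  have := List.all_eq_true.1 h m (List.mem_range.2 hm)
  simpa [fastPop_eq hm, h5] using this

end Witt12

/-- The Witt design `S(5, 6, 12)`. -/
def witt12 : SteinerSystem 5 6 12 (Option (ZMod 11)) where
  card_points := by simp [ZMod.card]
  blocks := wittBlocks12
  card_block := fun B hB => hB.1
  existsUnique_block := by
    intro T hT
    have h := Witt12.check _ (Witt12.mask_lt T) (by rw [← Witt12.card_eq_pop, hT])
    obtain ⟨j, hj⟩ := List.length_eq_one_iff.1 h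
    have key : ∀ i : Fin 12, (Witt12.pt i ∉ T ∧ insert (Witt12.pt i) T ∈ wittBlocks12) ↔
        (i : ℕ) = j := by
      intro i
      rw [Witt12.mem_blocks_iff, Witt12.mask_insert]
      have := congrArg (fun l => (i : ℕ) ∈ l) hj
      simpa [Witt12.completions, Witt12.strict_eq, Witt12.testBit_mask] using this
    obtain ⟨j, rfl⟩ : ∃ i : Fin 12, (i : ℕ) = j := by
      have hm : j ∈ Witt12.completions (Witt12.mask T) := by simp [hj]
      exact ⟨⟨j, List.mem_range.1 (List.mem_filter.1 hm).1⟩, rfl⟩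
    refine ⟨insert (Witt12.pt j) T, ⟨((key j).2 rfl).2, Finset.subset_insert _ _⟩, ?_⟩
    rintro B ⟨hB, hTB⟩
    obtain ⟨x, hx, rfl⟩ := Finset.exists_eq_insert_iff.2 ⟨hTB, by rw [hT, hB.1]⟩
    obtain ⟨i, rfl⟩ := Witt12.pt.surjective x
    rw [Fin.ext ((key i).1 ⟨hx, hB⟩)]

namespace Witt24

/-- Numbering of the points. -/
def pt : Fin 24 ≃ Option (ZMod 23) := finSuccEquivLast

/-- For each of the 24 points, the number whose digit `j < 11` says whether the `j`-th translate of
the squares contains the point. -/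
def cols : List ℕ :=
  [1185, 323, 647, 1295, 543, 1086, 125, 250, 501, 1003, 2006, 1964, 1881, 1715, 1382, 716,
   1433, 818, 1637, 1226, 404, 808, 1616, 0]

/-- For each of the 23 translates of the squares, the number whose digit `j < 11` says whether the
`j`-th translate occurs in its expression as a symmetric difference of the first 11 translates. -/
def rels : List ℕ :=
  [1, 2, 4, 8, 16, 32, 64, 128, 256, 512, 1024, 739, 1478, 367, 734, 1468, 411, 822, 1644,
   1595, 1685, 1993, 1393]

/-- Bitwise disjunction over a list. -/
def orAll {α : Type*} (l : List α) (f : α → ℕ) : ℕ := l.foldr (fun a n => f a ||| n) 0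

theorem exists_of_testBit_orAll {α : Type*} {l : List α} {f : α → ℕ} {n : ℕ}
    (h : (orAll l f).testBit n = true) : ∃ a ∈ l, (f a).testBit n = true := by
  induction l with
  | nil => simp [orAll] at h
  | cons a l ih =>
    have h' : (f a ||| orAll l f).testBit n = true := h
    rw [Nat.testBit_or, Bool.or_eq_true] at h'
    rcases h' with h' | h'
    · exact ⟨a, by simp, h'⟩
    · obtain ⟨b, hb, hb'⟩ := ih h'
      exact ⟨b, by simp [hb], hb'⟩

/-- The incidence of a point and a translate of the squares, modulo 2. -/
def inc (i : ZMod 23) (x : Option (ZMod 23)) : ZMod 2 := if x ∈ squareTranslate 23 i then 1 else 0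

/-- The size modulo 2 of the intersection with a translate of the squares. -/
def par (B : Finset (Option (ZMod 23))) (i : ZMod 23) : ZMod 2 := ∑ x ∈ B, inc i x

theorem par_eq_zero_iff (B : Finset (Option (ZMod 23))) (i : ZMod 23) :
    par B i = 0 ↔ Even (B ∩ squareTranslate 23 i).card := by
  rw [← ZMod.natCast_eq_zero_iff_even, par]
  simp [inc]

theorem par_symmDiff (A B : Finset (Option (ZMod 23))) (i : ZMod 23) :
    par (symmDiff A B) i = par A i + par B i := by
  have h : Disjoint (A \ B) (B \ A) := disjoint_sdiff_sdiff
  have hA : par A i = par (A \ B) i + par (A ∩ B) i := by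
    unfold par
    rw [← Finset.sum_union (Finset.disjoint_sdiff_inter A B), Finset.sdiff_union_inter]
  have hB : par B i = par (B \ A) i + par (A ∩ B) i := by
    unfold par
    rw [Finset.inter_comm, ← Finset.sum_union (Finset.disjoint_sdiff_inter B A),
      Finset.sdiff_union_inter]
  have hS : par (symmDiff A B) i = par (A \ B) i + par (B \ A) i := by
    unfold par
    rw [← Finset.sum_union h]
    rfl
  rw [hA, hB, hS]
  have h2 : par (A ∩ B) i + par (A ∩ B) i = 0 := CharTwo.add_self_eq_zero _
  linear_combination - h2

theorem card_symmDiff_add (A B : Finset (Option (ZMod 23))) :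
    (symmDiff A B).card + 2 * (A ∩ B).card = A.card + B.card := by
  have h : (symmDiff A B).card = (A \ B).card + (B \ A).card :=
    Finset.card_union_of_disjoint disjoint_sdiff_sdiff
  have h1 := Finset.card_sdiff_add_card_inter A B
  have h2 := Finset.card_sdiff_add_card_inter B A
  rw [Finset.inter_comm] at h2
  omega

theorem inc_pt (j : Fin 11) (a : Fin 24) :
    inc ((j : ℕ) : ZMod 23) (pt a) = ((cols.getD a 0).testBit j).toNat := by
  revert j a
  decide +kernel

theorem inc_eq_sum (i : ZMod 23) (a : Fin 24) :
    inc i (pt a) =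
      ∑ j : Fin 11, if (rels.getD i.val 0).testBit j then inc ((j : ℕ) : ZMod 23) (pt a) else 0 := by
  revert i a
  decide +kernel

theorem par_eq_sum (B : Finset (Option (ZMod 23))) (i : ZMod 23) :
    par B i =
      ∑ j : Fin 11, if (rels.getD i.val 0).testBit j then par B ((j : ℕ) : ZMod 23) else 0 := by
  have h : ∀ x ∈ B, inc i x =
      ∑ j : Fin 11, if (rels.getD i.val 0).testBit j then inc ((j : ℕ) : ZMod 23) x else 0 := by
    intro x _
    obtain ⟨a, rfl⟩ := pt.surjective x
    exact inc_eq_sum i a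
  unfold par
  rw [Finset.sum_congr rfl h, Finset.sum_comm]
  refine Finset.sum_congr rfl fun j _ => ?_
  split_ifs <;> simp

theorem par_ext {A B : Finset (Option (ZMod 23))}
    (h : ∀ j : Fin 11, par A ((j : ℕ) : ZMod 23) = par B ((j : ℕ) : ZMod 23)) (i : ZMod 23) :
    par A i = par B i := by
  rw [par_eq_sum A, par_eq_sum B]
  simp only [h]

theorem check :
    (orAll (List.finRange 24) fun a => orAll (List.finRange 24) fun b =>
      orAll (List.finRange 24) fun c =>
        if (a = b ∧ b = c) ∨ (a < b ∧ b < c) then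
          1 <<< (cols.getD a 0 ^^^ cols.getD b 0 ^^^ cols.getD c 0) else 0) = 2 ^ 2048 - 1 := by
  decide +kernel

/-- The sets of one or three points. -/
def small : Finset (Finset (Option (ZMod 23))) :=
  Finset.powersetCard 1 Finset.univ ∪ Finset.powersetCard 3 Finset.univ

theorem mem_small {S : Finset (Option (ZMod 23))} : S ∈ small ↔ S.card = 1 ∨ S.card = 3 := by
  simp [small, Finset.mem_powersetCard]

theorem card_small : small.card = 2048 := by
  rw [small, Finset.card_union_of_disjoint, Finset.card_powersetCard, Finset.card_powersetCard]
  · simp [ZMod.card]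
    decide
  · rw [Finset.disjoint_left]
    intro S h1 h3
    rw [Finset.mem_powersetCard] at h1 h3
    omega

theorem exists_small (v : Fin 11 → ZMod 2) :
    ∃ S ∈ small, ∀ j : Fin 11, par S ((j : ℕ) : ZMod 23) = v j := by
  set n := Nat.ofBits fun j => decide (v j = 1) with hn
  have hlt : n < 2048 := Nat.ofBits_lt_two_pow _
  have hb : (2 ^ 2048 - 1).testBit n = true := by
    rw [Nat.testBit_two_pow_sub_one]
    simpa using hlt
  rw [← check] at hb
  obtain ⟨a, -, ha⟩ := exists_of_testBit_orAll hb
  obtain ⟨b, -, hb⟩ := exists_of_testBit_orAll ha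
  obtain ⟨c, -, hc⟩ := exists_of_testBit_orAll hb
  split_ifs at hc with habc
  swap
  · simp at hc
  rw [Nat.one_shiftLeft, Nat.testBit_two_pow, decide_eq_true_eq] at hc
  have hv : ∀ j : Fin 11, inc ((j : ℕ) : ZMod 23) (pt a) + inc ((j : ℕ) : ZMod 23) (pt b) +
      inc ((j : ℕ) : ZMod 23) (pt c) = v j := by
    intro j
    have h1 : n.testBit j = decide (v j = 1) := by
      rw [hn, Nat.testBit_ofBits_lt _ _ j.2]
    rw [← hc, Nat.testBit_xor, Nat.testBit_xor] at h1
    rw [inc_pt, inc_pt, inc_pt]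
    generalize (cols.getD a 0).testBit j = x at *
    generalize (cols.getD b 0).testBit j = y at *
    generalize (cols.getD c 0).testBit j = z at *
    generalize v j = w at *
    revert x y z w
    decide
  rcases habc with ⟨rfl, rfl⟩ | ⟨hab, hbc⟩
  · refine ⟨{pt a}, mem_small.2 (Or.inl (by simp)), fun j => ?_⟩
    rw [← hv j]
    simp [par, CharTwo.add_self_eq_zero]
  · have h1 : pt a ≠ pt b := fun h => hab.ne (pt.injective h)
    have h2 : pt b ≠ pt c := fun h => hbc.ne (pt.injective h)
    have h3 : pt a ≠ pt c := fun h => (hab.trans hbc).ne (pt.injective h)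
    refine ⟨{pt a, pt b, pt c}, mem_small.2 (Or.inr ?_), fun j => ?_⟩
    · exact Finset.card_eq_three.2 ⟨_, _, _, h1, h3, h2, rfl⟩
    · rw [← hv j, par, Finset.sum_insert (by simp [h1, h3]), Finset.sum_pair h2, add_assoc]

theorem small_inj {S T : Finset (Option (ZMod 23))} (hS : S ∈ small) (hT : T ∈ small)
    (h : ∀ i, par S i = par T i) : S = T := by
  refine Finset.inj_on_of_surj_on_of_card_le (s := small)
    (t := (Finset.univ : Finset (Fin 11 → ZMod 2)))
    (fun S _ => fun j : Fin 11 => par S ((j : ℕ) : ZMod 23)) (fun _ _ => Finset.mem_univ _) ?_ ?_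
    hS hT (funext fun j => h _)
  · intro v _
    obtain ⟨S, hS, h⟩ := exists_small v
    exact ⟨S, hS, (funext h)⟩
  · rw [card_small]
    simp [ZMod.card]

theorem min_weight {D : Finset (Option (ZMod 23))} (hD : ∀ i, par D i = 0) (he : Even D.card)
    (h6 : D.card ≤ 6) : D = ∅ := by
  by_contra hne
  have hpos : 0 < D.card := Finset.card_pos.2 (Finset.nonempty_iff_ne_empty.2 hne)
  obtain ⟨k, hk⟩ := he
  obtain ⟨m, hm, hm1, hm2⟩ : ∃ m, m ≤ D.card ∧ (m = 1 ∨ m = 3) ∧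
      (D.card - m = 1 ∨ D.card - m = 3) := by
    have : k = 1 ∨ k = 2 ∨ k = 3 := by omega
    rcases this with rfl | rfl | rfl
    · exact ⟨1, by omega, by omega, by omega⟩
    · exact ⟨1, by omega, by omega, by omega⟩
    · exact ⟨3, by omega, by omega, by omega⟩
  obtain ⟨A, hA, hAc⟩ := Finset.exists_subset_card_eq hm
  have hc := Finset.card_sdiff_of_subset hA
  have hAs : A ∈ small := mem_small.2 (by omega)
  have hBs : D \ A ∈ small := mem_small.2 (by omega)
  have h := small_inj hAs hBs (by
    intro i
    have h1 : par (D \ A) i + par A i = 0 := by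
      rw [← hD i]
      exact Finset.sum_sdiff hA
    have h2 : par A i + par A i = 0 := CharTwo.add_self_eq_zero _
    linear_combination h2 - h1)
  have h1 : A.Nonempty := Finset.card_pos.1 (by omega)
  obtain ⟨x, hx⟩ := h1
  have hx' := hx
  rw [h] at hx'
  exact (Finset.mem_sdiff.1 hx').2 hx

theorem mem_blocks_iff (B : Finset (Option (ZMod 23))) :
    B ∈ wittBlocks24 ↔ B.card = 8 ∧ ∀ i, par B i = 0 := by
  simp only [par_eq_zero_iff]
  rfl

end Witt24

/-- The Witt design `S(5, 8, 24)`. -/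
def witt24 : SteinerSystem 5 8 24 (Option (ZMod 23)) where
  card_points := by simp [ZMod.card]
  blocks := wittBlocks24
  card_block := fun B hB => hB.1
  existsUnique_block := by
    intro T hT
    obtain ⟨S, hS, hpar⟩ := Witt24.exists_small fun j => Witt24.par T ((j : ℕ) : ZMod 23)
    have hST := Witt24.par_ext hpar
    have hS' := Witt24.mem_small.1 hS
    have hc := Witt24.card_symmDiff_add T S
    have hz : ∀ i, Witt24.par (symmDiff T S) i = 0 := by
      intro i
      rw [Witt24.par_symmDiff, hST]
      exact CharTwo.add_self_eq_zero _
    have hI : (T ∩ S).card ≤ S.card := Finset.card_le_card Finset.inter_subset_right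
    have h8 : ¬ (symmDiff T S).card ≤ 6 := by
      intro h6
      have he : Even (symmDiff T S).card := by
        rw [Nat.even_iff]
        omega
      have h0 := Witt24.min_weight hz he h6
      rw [h0, Finset.card_empty] at hc
      omega
    refine ⟨symmDiff T S, ⟨(Witt24.mem_blocks_iff _).2 ⟨by omega, hz⟩, ?_⟩, ?_⟩
    · have hemp : T ∩ S = ∅ := Finset.card_eq_zero.1 (by omega)
      have hd : Disjoint T S := Finset.disjoint_iff_inter_eq_empty.2 hemp
      rw [hd.symmDiff_eq_sup]
      exact Finset.subset_union_left
    · rintro B ⟨hB, hTB⟩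
      rw [Witt24.mem_blocks_iff] at hB
      have hTT : T ⊆ symmDiff T S := by
        have hemp : T ∩ S = ∅ := Finset.card_eq_zero.1 (by omega)
        have hd : Disjoint T S := Finset.disjoint_iff_inter_eq_empty.2 hemp
        rw [hd.symmDiff_eq_sup]
        exact Finset.subset_union_left
      have hcc := Witt24.card_symmDiff_add B (symmDiff T S)
      have h5 : 5 ≤ (B ∩ symmDiff T S).card := by
        rw [← hT]
        exact Finset.card_le_card (Finset.subset_inter hTB hTT)
      have h0 := Witt24.min_weight (D := symmDiff B (symmDiff T S)) (by
        intro i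
        rw [Witt24.par_symmDiff, hB.2, hz, add_zero]) (by
        rw [Nat.even_iff]
        omega) (by omega)
      exact symmDiff_eq_bot.1 h0

/-! ### The Mathieu groups -/

/-- `M₁₂`, the automorphism group of `S(5, 6, 12)`. -/
def mathieu12 : Subgroup (Equiv.Perm (Option (ZMod 11))) := witt12.aut

/-- `M₁₁`, the automorphism group of `S(4, 5, 11)`. -/
def mathieu11 : Subgroup (Equiv.Perm {x : Option (ZMod 11) // x ≠ none}) :=
  (witt12.derived none).aut

/-- `M₂₄`, the automorphism group of `S(5, 8, 24)`. -/
def mathieu24 : Subgroup (Equiv.Perm (Option (ZMod 23))) := witt24.aut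

/-- `M₂₃`, the automorphism group of `S(4, 7, 23)`. -/
def mathieu23 : Subgroup (Equiv.Perm {x : Option (ZMod 23) // x ≠ none}) :=
  (witt24.derived none).aut

/-- `M₂₂`, the stabilizer of a point in `M₂₃`. On the remaining 22 points it is the subgroup of
index 2 in the full automorphism group of the derived system `S(3, 6, 22)`. -/
def mathieu22 : Subgroup mathieu23 :=
  MulAction.stabilizer mathieu23
    (⟨some 0, Option.some_ne_none 0⟩ : {x : Option (ZMod 23) // x ≠ none})

/-!
A random subproduct of a finite group corresponds to a product of factors `(1 - p) + p g` in the
real group algebra, and a group is mixable if the uniform distribution is such a product. Two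
principles propagate mixability from a subgroup `H` to a group `G`.

* If `G = H ∪ HgH`, the product `h g^ε h'` with uniform `h, h'` in `H` is uniform on `G` for a
  suitable `p` (`IsMixable.of_doubleCoset`). This applies to subgroups of index 2, so that finite
  2-groups are mixable (`IsMixable.of_card_eq_two_pow`), and to point stabilizers in doubly
  transitive groups (`MixableTransitive.of_stabilizer`).
* If a random subproduct of `G` is uniform on the cosets of `H`, then `G` is mixable
  (`IsMixable.of_walkProb`).

The group `M₁₂` is sharply 5-transitive. The pointwise stabilizer of four points is a 2-group of
order 8, and four doubly transitive extensions lead through `M₁₁` to `M₁₂`.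

The group `M₂₄` is 5-transitive, but the stabilizer of five points, of order 48, has a quotient of
order 3 and is not mixable. So the descent stops at the pointwise stabilizer `2⁴ : A₅` of four
points. It acts as `A₅` on the five tetrads that complete these points to an octad, hence
transitively on the 30 colourings of the tetrads with class sizes 2, 1 and 2, and an explicit walk
is uniform on them (`Witt24.walkProb_coloringWalk`). The stabilizer of a colouring is a group of
order 32. Four doubly transitive extensions lead through `M₂₂` and `M₂₃` to `M₂₄`.

The groups `M₁₁` and `M₂₃` are defined by derived designs, and an automorphism of a derived design
is only known to preserve the blocks through `∞` (`SteinerSystem.autThrough`). That these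
permutations preserve all blocks is not needed: the arguments apply to all groups between the
stabilizer of `∞` in the automorphism group and this group. They use explicit automorphisms for
transitivity, and only blocks through `∞` to show that the last stabilizer is trivial.
-/

/-! ### Random subproducts in the group algebra -/

section GroupAlgebra

variable {A : Type*} [Group A]

/-- The distribution of `g ^ ε` for `ε ∼ Ber(p)`, as an element of the group algebra. -/
noncomputable def bernoulliPow (g : A) (p : ℝ) : MonoidAlgebra ℝ A :=
  MonoidAlgebra.single 1 (1 - p) + MonoidAlgebra.single g p

/-- The distributions of the random subproducts of elements of the subgroup `G`, inside the group
algebra of an ambient group: independent products correspond to products in the algebra. -/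
noncomputable def randomSubproducts (G : Subgroup A) : Submonoid (MonoidAlgebra ℝ A) :=
  Submonoid.closure {w | ∃ g ∈ G, ∃ p : ℝ, 0 ≤ p ∧ p ≤ 1 ∧ w = bernoulliPow g p}

/-- A subgroup is mixable, in terms of distributions on an ambient group. -/
def IsMixable (G : Subgroup A) : Prop :=
  ∃ w ∈ randomSubproducts G, ∀ x ∈ G, w.coeff x = 1 / (Nat.card G : ℝ)

theorem bernoulliPow_mem {G : Subgroup A} {g : A} (hg : g ∈ G) {p : ℝ} (h0 : 0 ≤ p) (h1 : p ≤ 1) :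
    bernoulliPow g p ∈ randomSubproducts G :=
  Submonoid.subset_closure ⟨g, hg, p, h0, h1, rfl⟩

theorem randomSubproducts_mono {H G : Subgroup A} (h : H ≤ G) :
    randomSubproducts H ≤ randomSubproducts G :=
  Submonoid.closure_mono fun _ ⟨g, hg, r⟩ => ⟨g, h hg, r⟩

theorem coeff_bernoulliPow_mul (g : A) (p : ℝ) (w : MonoidAlgebra ℝ A) (x : A) :
    (bernoulliPow g p * w).coeff x = (1 - p) * w.coeff x + p * w.coeff (g⁻¹ * x) := by
  rw [bernoulliPow, add_mul, MonoidAlgebra.coeff_add, Finsupp.add_apply,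
    MonoidAlgebra.coeff_single_mul_apply, MonoidAlgebra.coeff_single_mul_apply]
  simp

theorem coeff_mul_bernoulliPow (g : A) (p : ℝ) (w : MonoidAlgebra ℝ A) (x : A) :
    (w * bernoulliPow g p).coeff x = (1 - p) * w.coeff x + p * w.coeff (x * g⁻¹) := by
  rw [bernoulliPow, mul_add, MonoidAlgebra.coeff_add, Finsupp.add_apply,
    MonoidAlgebra.coeff_mul_single_apply, MonoidAlgebra.coeff_mul_single_apply]
  simp [mul_comm]

theorem randomSubproducts_induction {G : Subgroup A} {P : MonoidAlgebra ℝ A → Prop} (one : P 1)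
    (step : ∀ g ∈ G, ∀ p : ℝ, 0 ≤ p → p ≤ 1 → ∀ w, P w → P (bernoulliPow g p * w))
    {w : MonoidAlgebra ℝ A} (hw : w ∈ randomSubproducts G) : P w := by
  induction hw using Submonoid.closure_induction_left with
  | one => exact one
  | mul_left x hx y hy ih =>
    obtain ⟨g, hg, p, h0, h1, rfl⟩ := hx
    exact step g hg p h0 h1 y ih

theorem coeff_one_apply [DecidableEq A] (x : A) :
    (1 : MonoidAlgebra ℝ A).coeff x = if x = 1 then 1 else 0 := by
  rw [MonoidAlgebra.one_def, MonoidAlgebra.coeff_single, Finsupp.single_apply]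
  simp only [eq_comm]

theorem coeff_nonneg_of_mem {G : Subgroup A} {w : MonoidAlgebra ℝ A}
    (hw : w ∈ randomSubproducts G) :
    ∀ x, 0 ≤ w.coeff x := by
  classical
  refine randomSubproducts_induction (P := fun w => ∀ x, 0 ≤ w.coeff x) ?_ ?_ hw
  · intro x
    rw [coeff_one_apply]
    split_ifs <;> norm_num
  · intro g _ p h0 h1 w ih x
    rw [coeff_bernoulliPow_mul]
    exact add_nonneg (mul_nonneg (by linarith) (ih _)) (mul_nonneg h0 (ih _))

theorem coeff_eq_zero_of_mem {G : Subgroup A} {w : MonoidAlgebra ℝ A}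
    (hw : w ∈ randomSubproducts G) : ∀ x, x ∉ G → w.coeff x = 0 := by
  classical
  refine randomSubproducts_induction (P := fun w => ∀ x, x ∉ G → w.coeff x = 0) ?_ ?_ hw
  · intro x hx
    rw [coeff_one_apply, if_neg]
    rintro rfl
    exact hx G.one_mem
  · intro g hg p _ _ w ih x hx
    rw [coeff_bernoulliPow_mul, ih x hx, ih (g⁻¹ * x)]
    · simp
    · rwa [G.mul_mem_cancel_left (G.inv_mem hg)]

theorem sum_coeff_of_mem [Fintype A] {G : Subgroup A} {w : MonoidAlgebra ℝ A}
    (hw : w ∈ randomSubproducts G) : ∑ x, w.coeff x = 1 := by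
  classical
  refine randomSubproducts_induction (P := fun w => ∑ x, w.coeff x = 1) ?_ ?_ hw
  · simp [coeff_one_apply]
  · intro g _ p _ _ w ih
    have h : ∑ x, w.coeff (g⁻¹ * x) = 1 := by
      rw [← ih]
      exact Equiv.sum_comp (Equiv.mulLeft g⁻¹) _
    simp only [coeff_bernoulliPow_mul, Finset.sum_add_distrib, ← Finset.mul_sum, ih, h]
    ring

/-- A random subproduct whose distribution is constant on the subgroup is uniform, since the
total mass is 1. -/
theorem IsMixable.of_const [Finite A] {G : Subgroup A} {w : MonoidAlgebra ℝ A}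
    (hw : w ∈ randomSubproducts G) {c : ℝ} (hc : ∀ x ∈ G, w.coeff x = c) : IsMixable G := by
  classical
  have := Fintype.ofFinite A
  refine ⟨w, hw, fun x hx => ?_⟩
  have h1 := sum_coeff_of_mem hw
  have h2 : ∀ x, w.coeff x = if x ∈ G then c else 0 := by
    intro x
    split_ifs with h
    · exact hc x h
    · exact coeff_eq_zero_of_mem hw x h
  simp only [h2] at h1
  rw [← Finset.sum_filter, Finset.sum_const, nsmul_eq_mul] at h1
  have h3 : (Finset.univ.filter (· ∈ G)).card = Nat.card G := by
    rw [Nat.card_eq_fintype_card, Fintype.card_subtype]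
  rw [h3] at h1
  rw [hc x hx]
  exact eq_one_div_of_mul_eq_one_right h1

theorem IsMixable.bot [Finite A] : IsMixable (⊥ : Subgroup A) := by
  refine IsMixable.of_const (c := 1) (Submonoid.one_mem _) ?_
  classical
  intro x hx
  rw [coeff_one_apply, if_pos (Subgroup.mem_bot.1 hx)]

/-- Mixability of a group, from that of its image under an embedding. -/
theorem mixable_of_isMixable_range {K : Type*} [Group K] [Finite K] (φ : K →* A)
    (hφ : Function.Injective φ) (h : IsMixable φ.range) : Mixable K := by
  classical
  obtain ⟨w, hw, hu⟩ := h
  -- A new factor on the left becomes the first entry of the sequences.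
  have key : ∃ (k : ℕ) (g : Fin k → K) (p : Fin k → ℝ), (∀ i, 0 ≤ p i ∧ p i ≤ 1) ∧
      ∀ x : K, subproductProb g p x = w.coeff (φ x) := by
    refine randomSubproducts_induction (P := fun w => ∃ (k : ℕ) (g : Fin k → K) (p : Fin k → ℝ),
      (∀ i, 0 ≤ p i ∧ p i ≤ 1) ∧ ∀ x : K, subproductProb g p x = w.coeff (φ x)) ?_ ?_ hw
    · refine ⟨0, Fin.elim0, Fin.elim0, fun i => i.elim0, fun x => ?_⟩
      rw [coeff_one_apply]
      have h1 : φ x = 1 ↔ 1 = x := by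
        rw [eq_comm, ← map_one φ, hφ.eq_iff]
      simp only [h1]
      simp only [subproductProb, subproduct, bernoulliWeight]
      split_ifs with h <;> simp [h]
    · rintro _ ⟨g₀, rfl⟩ p₀ h0 h1 w ⟨k, g, p, hp, hgp⟩
      refine ⟨k + 1, Fin.cons g₀ g, Fin.cons p₀ p, ?_, fun x => ?_⟩
      · intro i
        refine Fin.cases ?_ (fun j => ?_) i
        · simpa using ⟨h0, h1⟩
        · simpa using hp j
      · rw [coeff_bernoulliPow_mul, ← hgp, ← map_inv, ← map_mul, ← hgp]
        unfold subproductProb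
        simp only [Finset.sum_filter]
        rw [← Equiv.sum_comp (Fin.consEquiv fun _ => Bool), Fintype.sum_prod_type, Fintype.sum_bool,
          Finset.mul_sum, Finset.mul_sum, add_comm]
        congr 1
        · refine Finset.sum_congr rfl fun ε _ => ?_
          simp [Fin.consEquiv, subproduct, bernoulliWeight, Fin.prod_univ_succ, List.ofFn_succ]
          split_ifs with h <;> simp [h]
        · refine Finset.sum_congr rfl fun ε _ => ?_
          simp [Fin.consEquiv, subproduct, bernoulliWeight, Fin.prod_univ_succ, List.ofFn_succ,
            eq_inv_mul_iff_mul_eq]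
  obtain ⟨k, g, p, hp, h⟩ := key
  refine ⟨k, g, p, hp, fun x => ?_⟩
  rw [h, hu _ ⟨x, rfl⟩, Nat.card_congr (MonoidHom.ofInjective hφ).toEquiv]

/-- If `H` is mixable and `G = H ∪ HgH`, then `G` is mixable: for independent uniform `h, h'` in
`H`, the product `h g^ε h'` is uniform on each of the two double cosets, and the probability of
`ε = 1` can be chosen so that the two densities agree. -/
theorem IsMixable.of_doubleCoset [Finite A] {H G : Subgroup A} (hHG : H ≤ G) (hH : IsMixable H)
    {g : A} (hg : g ∈ G) (hgH : g ∉ H)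
    (h : ∀ x ∈ G, x ∉ H → ∃ a ∈ H, ∃ b ∈ H, x = a * g * b) : IsMixable G := by
  classical
  obtain ⟨e, he, heu⟩ := hH
  have hez := coeff_eq_zero_of_mem he
  -- The uniform element `e` of `H` absorbs the elements of `H`.
  have hleft : ∀ a ∈ H, MonoidAlgebra.single a (1 : ℝ) * e = e := by
    intro a ha
    ext x
    rw [MonoidAlgebra.coeff_single_mul_apply, one_mul]
    by_cases hx : x ∈ H
    · rw [heu x hx, heu _ (H.mul_mem (H.inv_mem ha) hx)]
    · rw [hez x hx, hez]
      rwa [H.mul_mem_cancel_left (H.inv_mem ha)]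
  have hright : ∀ a ∈ H, e * MonoidAlgebra.single a (1 : ℝ) = e := by
    intro a ha
    ext x
    rw [MonoidAlgebra.coeff_mul_single_apply, mul_one]
    by_cases hx : x ∈ H
    · rw [heu x hx, heu _ (H.mul_mem hx (H.inv_mem ha))]
    · rw [hez x hx, hez]
      rwa [H.mul_mem_cancel_right (H.inv_mem ha)]
  have hinv : ∀ (u : MonoidAlgebra ℝ A), ∀ a ∈ H, ∀ b ∈ H, ∀ x,
      (e * u * e).coeff (a * x * b) = (e * u * e).coeff x := by
    intro u a ha b hb x
    have : e * u * e = MonoidAlgebra.single a (1 : ℝ) * (e * u * e) *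
        MonoidAlgebra.single b (1 : ℝ) := by
      rw [mul_assoc (MonoidAlgebra.single a 1), mul_assoc (e * u), hright b hb, ← mul_assoc,
        ← mul_assoc, hleft a ha]
    conv_lhs => rw [this]
    rw [MonoidAlgebra.coeff_mul_single_apply, MonoidAlgebra.coeff_single_mul_apply]
    simp [mul_assoc]
  set v := e * MonoidAlgebra.single g (1 : ℝ) * e with hv
  have hvG : ∀ x, 0 ≤ v.coeff x := by
    have : v ∈ randomSubproducts G := by
      have hs : MonoidAlgebra.single g (1 : ℝ) = bernoulliPow g 1 := by simp [bernoulliPow]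
      have he' := randomSubproducts_mono hHG he
      rw [hv, hs]
      exact mul_mem (mul_mem he' (bernoulliPow_mem hg zero_le_one le_rfl)) he'
    exact coeff_nonneg_of_mem this
  have hee : e * e ∈ randomSubproducts H := mul_mem he he
  have heeG : ∀ x, 0 ≤ (e * e).coeff x := coeff_nonneg_of_mem hee
  have hv1 : v.coeff 1 = 0 := by
    rw [hv, mul_assoc, MonoidAlgebra.coeff_mul_apply_left]
    refine Finset.sum_eq_zero fun a _ => ?_
    by_cases ha : a ∈ H
    · simp only [MonoidAlgebra.coeff_single_mul_apply]
      rw [hez (g⁻¹ * (a⁻¹ * 1))]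
      · simp
      · intro hm
        rw [mul_one, H.mul_mem_cancel_right (H.inv_mem ha)] at hm
        exact hgH (inv_mem_iff.1 hm)
    · simp [hez a ha]
  -- The density is a multiple of `1 - p` on `H` and of `p` on `HgH`.
  set α := (e * e).coeff 1 with hα
  set β := v.coeff g with hβ
  obtain ⟨p, h0, h1, hp⟩ : ∃ p : ℝ, 0 ≤ p ∧ p ≤ 1 ∧ (1 - p) * α = p * β := by
    rcases (add_nonneg (heeG 1) (hvG g)).eq_or_lt with hz | hpos
    · refine ⟨0, le_rfl, zero_le_one, ?_⟩
      have := heeG 1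
      have := hvG g
      have : α = 0 := by linarith
      rw [this]
      simp
    · refine ⟨α / (α + β), div_nonneg (heeG 1) hpos.le, (div_le_one hpos).2 ?_, ?_⟩
      · linarith [hvG g]
      · have hne : α + β ≠ 0 := hpos.ne'
        field_simp
        ring
  have hw : e * bernoulliPow g p * e = (1 - p) • (e * 1 * e) + p • v := by
    have h2 : bernoulliPow g p = (1 - p) • (1 : MonoidAlgebra ℝ A) +
        p • MonoidAlgebra.single g (1 : ℝ) := by
      ext x
      simp [bernoulliPow, MonoidAlgebra.one_def]
    rw [h2, hv]
    simp only [mul_add, add_mul, mul_smul_comm, smul_mul_assoc]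
  have he' := randomSubproducts_mono hHG he
  have hwmem : e * bernoulliPow g p * e ∈ randomSubproducts G :=
    mul_mem (mul_mem he' (bernoulliPow_mem hg h0 h1)) he'
  refine IsMixable.of_const (c := (1 - p) * α) hwmem fun x hx => ?_
  by_cases hxH : x ∈ H
  · have := hinv (bernoulliPow g p) x hxH 1 H.one_mem 1
    rw [mul_one, mul_one] at this
    rw [this, hw, MonoidAlgebra.coeff_add, Finsupp.add_apply, MonoidAlgebra.coeff_smul_apply,
      MonoidAlgebra.coeff_smul_apply, hv1, mul_one]
    simp [hα]
  · obtain ⟨a, ha, b, hb, rfl⟩ := h x hx hxH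
    rw [hinv _ a ha b hb, hw, MonoidAlgebra.coeff_add, Finsupp.add_apply,
      MonoidAlgebra.coeff_smul_apply, MonoidAlgebra.coeff_smul_apply, mul_one,
      coeff_eq_zero_of_mem hee g hgH, hp]
    simp [hβ]

/-- Finite 2-groups are mixable, by induction along a chain of subgroups of index 2. -/
theorem IsMixable.of_card_eq_two_pow [Finite A] (n : ℕ) :
    ∀ G : Subgroup A, Nat.card G = 2 ^ n → IsMixable G := by
  induction n with
  | zero =>
    intro G hG
    rw [pow_zero, Subgroup.card_eq_one] at hG
    rw [hG]
    exact IsMixable.bot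
  | succ n ih =>
    intro G hG
    obtain ⟨K, hK⟩ := Sylow.exists_subgroup_card_pow_prime (G := G) 2 (n := n)
      (by rw [hG]; exact pow_dvd_pow 2 n.le_succ)
    have hidx : K.index = 2 := by
      have := K.card_mul_index
      rw [hK, hG, pow_succ] at this
      exact Nat.eq_of_mul_eq_mul_left (by positivity) this
    have hH : IsMixable (K.map G.subtype) :=
      ih _ (by rw [← hK]; exact Subgroup.card_map_of_injective G.subtype_injective)
    obtain ⟨g, hg⟩ : ∃ g, g ∉ K := by
      by_contra! hall
      rw [(Subgroup.eq_top_iff' K).2 hall, Subgroup.index_top] at hidx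
      omega
    have hmem : ∀ x : G, (x : A) ∈ K.map G.subtype ↔ x ∈ K := by
      intro x
      simp
    refine IsMixable.of_doubleCoset (Subgroup.map_subtype_le K) hH g.2 (by rwa [hmem]) ?_
    intro x hx hxH
    lift x to G using hx
    rw [hmem] at hxH
    refine ⟨_, (hmem (x * g⁻¹)).2 ?_, 1, Subgroup.one_mem _, by simp⟩
    rw [Subgroup.mul_mem_iff_of_index_two hidx, inv_mem_iff]
    tauto

/-- The law of a lazy walk on labels, from the label `c₁`, evaluated at a label by going backwards:
the entry `(i, p)` of the list, in which the last step comes first, stands for a step that with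
probability `p` leads to the label `c` from `α i c`. -/
def walkProb {C ι : Type*} [DecidableEq C] (α : ι → C → C) (c₁ : C) : List (ι × ℚ) → C → ℚ
  | [], c => if c = c₁ then 1 else 0
  | (i, p) :: L, c => (1 - p) * walkProb α c₁ L c + p * walkProb α c₁ L (α i c)

/-- If `H` is mixable and a random subproduct of `G` is uniform on the right cosets of `H`, then `G`
is mixable. The cosets are given by labels, on which `α i` describes multiplication by
`(g i)⁻¹`. -/
theorem IsMixable.of_walkProb [Finite A] {H G : Subgroup A} (hHG : H ≤ G) (hH : IsMixable H)
    {C ι : Type*} [DecidableEq C] (κ : A → C) (hκ : ∀ z ∈ G, κ z = κ 1 ↔ z ∈ H)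
    (g : ι → A) (hg : ∀ i, g i ∈ G) (α : ι → C → C)
    (hα : ∀ i, ∀ z ∈ G, κ (z * (g i)⁻¹) = α i (κ z)) (L : List (ι × ℚ))
    (hL : ∀ s ∈ L, 0 ≤ s.2 ∧ s.2 ≤ 1) {c : ℚ} (hc : ∀ z ∈ G, walkProb α (κ 1) L (κ z) = c) :
    IsMixable G := by
  obtain ⟨e, he, heu⟩ := hH
  have hez := coeff_eq_zero_of_mem he
  obtain ⟨w, hw, hwc⟩ : ∃ w ∈ randomSubproducts G, ∀ z ∈ G,
      w.coeff z = 1 / (Nat.card H : ℝ) * (walkProb α (κ 1) L (κ z) : ℝ) := by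
    clear hc
    induction L with
    | nil =>
      refine ⟨e, randomSubproducts_mono hHG he, fun z hz => ?_⟩
      simp only [walkProb]
      split_ifs with h <;> rw [hκ z hz] at h
      · simp [heu z h]
      · simp [hez z h]
    | cons s L ih =>
      obtain ⟨i, p⟩ := s
      obtain ⟨w, hw, hwc⟩ := ih fun s hs => hL s (List.mem_cons_of_mem _ hs)
      obtain ⟨h0, h1⟩ := hL (i, p) List.mem_cons_self
      refine ⟨w * bernoulliPow (g i) p,
        mul_mem hw (bernoulliPow_mem (hg i) (by exact_mod_cast h0) (by exact_mod_cast h1)),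
        fun z hz => ?_⟩
      rw [coeff_mul_bernoulliPow, hwc z hz, hwc _ (G.mul_mem hz (G.inv_mem (hg i))), hα i z hz]
      simp only [walkProb]
      push_cast
      ring
  exact IsMixable.of_const hw fun x hx => by rw [hwc x hx, hc x hx]

end GroupAlgebra

/-! ### Permutation groups -/

section PermGroup

variable {X : Type*}

open MulAction in
/-- A permutation group is mixable if it has at most one further double coset of the stabilizer of a
point, that is, if the stabilizer is transitive on the remaining part of the orbit, and if the
stabilizer is mixable. -/
theorem IsMixable.of_stabilizer [Finite X] {G : Subgroup (Equiv.Perm X)} (x : X)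
    (hH : IsMixable (G ⊓ stabilizer (Equiv.Perm X) x)) {g : Equiv.Perm X} (hg : g ∈ G)
    (hgx : g x ≠ x)
    (h : ∀ s ∈ G, s x ≠ x → ∃ a ∈ G ⊓ stabilizer (Equiv.Perm X) x, a (g x) = s x) :
    IsMixable G := by
  refine IsMixable.of_doubleCoset inf_le_left hH hg (fun hm => hgx hm.2) fun s hs hsH => ?_
  obtain ⟨a, ha, hax⟩ := h s hs fun he => hsH ⟨hs, he⟩
  refine ⟨a, ha, g⁻¹ * a⁻¹ * s, ⟨G.mul_mem (G.mul_mem (G.inv_mem hg) (G.inv_mem ha.1)) hs, ?_⟩,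
    by group⟩
  change (g⁻¹ * a⁻¹ * s) x = x
  rw [Equiv.Perm.mul_apply, ← hax]
  simp

/-- A mixable permutation group that fixes the points of `F` and is transitive on the others. -/
structure MixableTransitive (G : Subgroup (Equiv.Perm X)) (F : Set X) : Prop where
  isMixable : IsMixable G
  fixes : ∀ σ ∈ G, ∀ x ∈ F, σ x = x
  transitive : ∀ x ∉ F, ∀ y ∉ F, ∃ σ ∈ G, σ x = y

open MulAction in
/-- The passage from a point stabilizer to a doubly transitive group. -/
theorem MixableTransitive.of_stabilizer [Finite X] {G : Subgroup (Equiv.Perm X)} {F : Set X} {x : X}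
    (h : MixableTransitive (G ⊓ stabilizer (Equiv.Perm X) x) (insert x F))
    (hF : ∀ σ ∈ G, ∀ y ∈ F, σ y = y) (hx : ∃ g ∈ G, g x ≠ x) : MixableTransitive G F := by
  obtain ⟨g, hg, hgx⟩ := hx
  have hxF : x ∉ F := fun hxF => hgx (hF g hg x hxF)
  have hgF : ∀ σ ∈ G, σ x ∉ F := fun σ hσ hm => hxF (by
    have := hF σ hσ _ hm
    rwa [σ.injective this] at hm)
  have hmove : ∀ y ∉ F, ∃ σ ∈ G, σ x = y := by
    intro y hy
    by_cases hyx : y = x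
    · exact ⟨1, G.one_mem, by simp [hyx]⟩
    · obtain ⟨a, ha, hay⟩ := h.transitive (g x) (by simp [hgx, hgF g hg]) y (by simp [hyx, hy])
      exact ⟨a * g, G.mul_mem ha.1 hg, hay⟩
  refine ⟨IsMixable.of_stabilizer x h.isMixable hg hgx fun s hs hsx => ?_, hF,
    fun y hy z hz => ?_⟩
  · exact h.transitive (g x) (by simp [hgx, hgF g hg]) (s x) (by simp [hsx, hgF s hs])
  · obtain ⟨σ, hσ, rfl⟩ := hmove y hy
    obtain ⟨τ, hτ, rfl⟩ := hmove z hz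
    exact ⟨τ * σ⁻¹, G.mul_mem hτ (G.inv_mem hσ), by simp⟩

open MulAction in
/-- The orbit-stabilizer theorem, for an orbit `S` that is known from both sides. -/
theorem card_eq_card_mul_card_stabilizer [Finite X] {G : Subgroup (Equiv.Perm X)} {x : X}
    {S : Finset X} (h₁ : ∀ σ ∈ G, σ x ∈ S) (h₂ : ∀ y ∈ S, ∃ σ ∈ G, σ x = y) :
    Nat.card G = S.card * Nat.card ↥(G ⊓ stabilizer (Equiv.Perm X) x) := by
  have horb : orbit G x = (S : Set X) := by
    ext y
    constructor
    · rintro ⟨σ, rfl⟩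
      exact h₁ σ σ.2
    · intro hy
      obtain ⟨σ, hσ, rfl⟩ := h₂ y hy
      exact ⟨⟨σ, hσ⟩, rfl⟩
  have h3 : Nat.card (stabilizer G x) = Nat.card ↥(G ⊓ stabilizer (Equiv.Perm X) x) := by
    rw [← Subgroup.card_map_of_injective (f := G.subtype) G.subtype_injective]
    congr 2
    ext σ
    simp only [Subgroup.mem_map, mem_stabilizer_iff, Subgroup.mem_inf]
    constructor
    · rintro ⟨τ, hτ, rfl⟩
      exact ⟨τ.2, hτ⟩
    · rintro ⟨h1, h2⟩
      exact ⟨⟨σ, h1⟩, h2, rfl⟩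
  rw [← h3, ← (stabilizer G x).index_mul_card, index_stabilizer, horb, Set.ncard_coe_finset]

end PermGroup

/-! ### Automorphisms of Steiner systems -/

theorem Finset.exists_map_equiv_eq {X Y : Type*} (e : X ≃ Y) (B : Finset Y) :
    ∃ C : Finset X, C.map e.toEmbedding = B :=
  ⟨B.map e.symm.toEmbedding, by ext x; simp⟩

section Steiner

open MulAction

variable {t k v : ℕ} {X Y : Type*} [Fintype X] [Fintype Y]

/-- A permutation that maps blocks to blocks is an automorphism, since there are finitely many
blocks. -/
theorem SteinerSystem.mem_aut_of_map_mem {S : SteinerSystem t k v X} {σ : Equiv.Perm X}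
    (h : ∀ B ∈ S.blocks, B.map σ.toEmbedding ∈ S.blocks) : σ ∈ S.aut := by
  intro B
  refine ⟨fun hB => ?_, h B⟩
  have hinj : Function.Injective fun C : S.blocks => (⟨_, h C C.2⟩ : S.blocks) := by
    intro C D hCD
    exact Subtype.ext (Finset.map_injective _ (congrArg Subtype.val hCD))
  obtain ⟨C, hC⟩ := Finite.surjective_of_injective hinj ⟨_, hB⟩
  rw [← Finset.map_injective _ (congrArg Subtype.val hC)]
  exact C.2

/-- The permutations that fix the point `x` and preserve the set of blocks through `x`. They are the
extensions of the automorphisms of the derived system at `x`. -/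
def SteinerSystem.autThrough (S : SteinerSystem t k v X) (x : X) : Subgroup (Equiv.Perm X) where
  carrier := {σ | σ x = x ∧ ∀ B : Finset X, x ∈ B → (B.map σ.toEmbedding ∈ S.blocks ↔ B ∈ S.blocks)}
  one_mem' := ⟨rfl, fun B _ => S.aut.one_mem B⟩
  mul_mem' := by
    rintro σ τ ⟨hσx, hσ⟩ ⟨hτx, hτ⟩
    refine ⟨by simp [hσx, hτx], fun B hB => ?_⟩
    have h : B.map (σ * τ).toEmbedding = (B.map τ.toEmbedding).map σ.toEmbedding :=
      (Finset.map_map τ.toEmbedding σ.toEmbedding B).symm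
    rw [h, hσ _ (Finset.mem_map.2 ⟨x, hB, hτx⟩), hτ B hB]
  inv_mem' := by
    rintro σ ⟨hσx, hσ⟩
    have hx : σ⁻¹ x = x := Equiv.Perm.inv_eq_iff_eq.2 hσx.symm
    refine ⟨hx, fun B hB => ?_⟩
    have h : (B.map (σ⁻¹ : Equiv.Perm X).toEmbedding).map σ.toEmbedding = B := by
      ext y; simp [Equiv.Perm.inv_def]
    have h2 := hσ (B.map (σ⁻¹ : Equiv.Perm X).toEmbedding) (Finset.mem_map.2 ⟨x, hB, hx⟩)
    rw [h] at h2
    exact h2.symm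

theorem SteinerSystem.aut_inf_stabilizer_le_autThrough (S : SteinerSystem t k v X) (x : X) :
    S.aut ⊓ stabilizer (Equiv.Perm X) x ≤ S.autThrough x :=
  fun _ hσ => ⟨hσ.2, fun B _ => hσ.1 B⟩

theorem SteinerSystem.range_derived_aut [DecidableEq X]
    (S : SteinerSystem (t + 1) (k + 1) (v + 1) X) (x : X) :
    (Equiv.Perm.ofSubtype.comp (S.derived x).aut.subtype).range = S.autThrough x := by
  have key : ∀ (τ : Equiv.Perm {y // y ≠ x}) (C : Finset {y // y ≠ x}),
      (insert x (C.map (Function.Embedding.subtype _))).map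
        (Equiv.Perm.ofSubtype τ).toEmbedding =
      insert x ((C.map τ.toEmbedding).map (Function.Embedding.subtype _)) := by
    intro τ C
    rw [Finset.map_insert]
    congr 1
    · exact Equiv.Perm.ofSubtype_apply_of_not_mem τ (by simp)
    · ext y
      simp only [Finset.mem_map, exists_exists_and_eq_and]
      refine exists_congr fun z => and_congr_right fun _ => ?_
      have : Equiv.Perm.ofSubtype τ (z : X) = τ z := Equiv.Perm.ofSubtype_apply_coe τ z
      exact Eq.congr_left this
  ext σ
  constructor
  · rintro ⟨⟨τ, hτ⟩, rfl⟩
    refine ⟨Equiv.Perm.ofSubtype_apply_of_not_mem τ (by simp), fun B hB => ?_⟩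
    obtain ⟨C, rfl⟩ : ∃ C : Finset {y // y ≠ x},
        insert x (C.map (Function.Embedding.subtype _)) = B := by
      refine ⟨B.subtype (fun y => y ≠ x), ?_⟩
      ext y
      by_cases hy : y = x <;> simp [hy, hB]
    have h := hτ C
    change insert x ((C.map τ.toEmbedding).map _) ∈ S.blocks ↔ insert x (C.map _) ∈ S.blocks at h
    rw [← h, ← key]
    rfl
  · rintro ⟨hσx, hσ⟩
    have hne : ∀ y, σ y ≠ x ↔ y ≠ x := fun y => by
      rw [not_iff_not]
      conv_lhs => rw [← hσx]
      exact σ.injective.eq_iff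
    have hof : Equiv.Perm.ofSubtype (σ.subtypePerm (p := fun y => y ≠ x) hne) = σ := by
      refine Equiv.Perm.ofSubtype_subtypePerm _ ?_
      rintro y hy rfl
      exact hy hσx
    refine ⟨⟨σ.subtypePerm hne, fun C => ?_⟩, hof⟩
    change insert x ((C.map _).map _) ∈ S.blocks ↔ insert x (C.map _) ∈ S.blocks
    have h := hσ _ (Finset.mem_insert_self x (C.map (Function.Embedding.subtype _)))
    rw [← h, ← key, hof]

/-- A Steiner system, transported along a bijection of the points. -/
def SteinerSystem.congr (S : SteinerSystem t k v X) (e : X ≃ Y) : SteinerSystem t k v Y where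
  card_points := by rw [← S.card_points, Fintype.card_congr e]
  blocks := {B | B.map e.symm.toEmbedding ∈ S.blocks}
  card_block := fun B hB => by rw [← S.card_block _ hB, Finset.card_map]
  existsUnique_block := by
    intro T hT
    obtain ⟨B, ⟨hB, hTB⟩, hu⟩ := S.existsUnique_block (T.map e.symm.toEmbedding)
      (by rw [Finset.card_map, hT])
    have h : ∀ C : Finset X, (C.map e.toEmbedding).map e.symm.toEmbedding = C := by
      intro C
      ext y
      simp
    refine ⟨B.map e.toEmbedding, ⟨?_, ?_⟩, ?_⟩
    · rw [Set.mem_ofPred_eq, h]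
      exact hB
    · rwa [← Finset.map_subset_map (f := e.symm.toEmbedding), h]
    · rintro C ⟨hC, hTC⟩
      rw [← hu _ ⟨hC, Finset.map_subset_map.2 hTC⟩]
      ext y
      simp

theorem SteinerSystem.map_permCongr_mem_congr_blocks (S : SteinerSystem t k v X) (e : X ≃ Y)
    (σ : Equiv.Perm X) (B : Finset X) :
    (B.map e.toEmbedding).map (e.permCongr σ).toEmbedding ∈ (S.congr e).blocks ↔
      B.map σ.toEmbedding ∈ S.blocks := by
  change ((B.map e.toEmbedding).map (e.permCongr σ).toEmbedding).map e.symm.toEmbedding ∈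
    S.blocks ↔ _
  have : ((B.map e.toEmbedding).map (e.permCongr σ).toEmbedding).map e.symm.toEmbedding =
      B.map σ.toEmbedding := by
    simp only [Finset.map_map]
    congr 1
    ext x
    simp
  rw [this]

theorem SteinerSystem.map_mem_congr_blocks (S : SteinerSystem t k v X) (e : X ≃ Y)
    (B : Finset X) : B.map e.toEmbedding ∈ (S.congr e).blocks ↔ B ∈ S.blocks := by
  change (B.map e.toEmbedding).map e.symm.toEmbedding ∈ S.blocks ↔ _
  have : (B.map e.toEmbedding).map e.symm.toEmbedding = B := by
    ext x
    simp
  rw [this]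

theorem SteinerSystem.map_aut (S : SteinerSystem t k v X) (e : X ≃ Y) :
    S.aut.map e.permCongrHom.toMonoidHom = (S.congr e).aut := by
  ext τ
  obtain ⟨σ, rfl⟩ := e.permCongr.surjective τ
  have h : e.permCongr σ ∈ S.aut.map e.permCongrHom.toMonoidHom ↔ σ ∈ S.aut :=
    Subgroup.mem_map_iff_mem e.permCongrHom.injective
  rw [h]
  constructor
  · intro hσ B
    obtain ⟨C, rfl⟩ := Finset.exists_map_equiv_eq e B
    rw [S.map_permCongr_mem_congr_blocks, S.map_mem_congr_blocks]
    exact hσ C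
  · intro hσ C
    rw [← S.map_permCongr_mem_congr_blocks e, ← S.map_mem_congr_blocks e]
    exact hσ _

theorem SteinerSystem.map_autThrough (S : SteinerSystem t k v X) (e : X ≃ Y) (x : X) :
    (S.autThrough x).map e.permCongrHom.toMonoidHom = (S.congr e).autThrough (e x) := by
  ext τ
  obtain ⟨σ, rfl⟩ := e.permCongr.surjective τ
  have h : e.permCongr σ ∈ (S.autThrough x).map e.permCongrHom.toMonoidHom ↔
      σ ∈ S.autThrough x :=
    Subgroup.mem_map_iff_mem e.permCongrHom.injective
  rw [h]
  have hx : e.permCongr σ (e x) = e x ↔ σ x = x := by simp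
  constructor
  · rintro ⟨hσx, hσ⟩
    refine ⟨hx.2 hσx, fun B hB => ?_⟩
    obtain ⟨C, rfl⟩ := Finset.exists_map_equiv_eq e B
    rw [S.map_permCongr_mem_congr_blocks, S.map_mem_congr_blocks]
    exact hσ C (by simpa using hB)
  · rintro ⟨hσx, hσ⟩
    refine ⟨hx.1 hσx, fun C hC => ?_⟩
    rw [← S.map_permCongr_mem_congr_blocks e, ← S.map_mem_congr_blocks e]
    exact hσ _ (by simpa using hC)

theorem SteinerSystem.block_eq_of_subset {S : SteinerSystem t k v X} {B C T : Finset X}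
    (hB : B ∈ S.blocks) (hC : C ∈ S.blocks) (hT : T.card = t) (hTB : T ⊆ B) (hTC : T ⊆ C) :
    B = C :=
  (S.existsUnique_block T hT).unique ⟨hB, hTB⟩ ⟨hC, hTC⟩

/-- A block through `x` is invariant if `t` of its points are fixed. -/
theorem SteinerSystem.apply_mem_block_iff {S : SteinerSystem t k v X} {x : X} {σ : Equiv.Perm X}
    (hσ : σ ∈ S.autThrough x) {B T : Finset X} (hB : B ∈ S.blocks) (hx : x ∈ B) (hTB : T ⊆ B)
    (hT : T.card = t) (hfix : ∀ y ∈ T, σ y = y) (y : X) : σ y ∈ B ↔ y ∈ B := by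
  have h : B.map σ.toEmbedding = B := by
    refine S.block_eq_of_subset ((hσ.2 B hx).2 hB) hB hT (fun y hy => ?_) hTB
    exact Finset.mem_map.2 ⟨y, hTB hy, hfix y hy⟩
  conv_lhs => rw [← h]
  simp

/-- A point of a block through `x` is fixed if the other points of the block are fixed. -/
theorem SteinerSystem.apply_eq_of_erase [DecidableEq X] {S : SteinerSystem t (t + 1) v X} {x : X}
    {σ : Equiv.Perm X} (hσ : σ ∈ S.autThrough x) {B : Finset X} (hB : B ∈ S.blocks) (hx : x ∈ B)
    {y : X} (hy : y ∈ B) (hfix : ∀ z ∈ B.erase y, σ z = z) : σ y = y := by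
  have h := (S.apply_mem_block_iff hσ hB hx (B.erase_subset y)
    (by rw [Finset.card_erase_of_mem hy, S.card_block B hB, Nat.add_sub_cancel]) hfix y).2 hy
  by_contra hne
  exact hne (σ.injective (hfix _ (Finset.mem_erase.2 ⟨hne, h⟩)))

theorem Equiv.Perm.apply_notMem_of_fixes {X : Type*} {σ : Equiv.Perm X} {F : Set X}
    (hF : ∀ y ∈ F, σ y = y) {x : X} (hx : x ∉ F) : σ x ∉ F := fun h =>
  hx (by rwa [← σ.injective (hF _ h)])

end Steiner

/-! ### Permutations given by cycles -/

/-- The product of the cycles in a list. -/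
def permOfCycles {n : ℕ} (l : List (List (Fin n))) : Equiv.Perm (Fin n) :=
  (l.map List.formPerm).prod

open MulAction

/-! ### The groups `M₁₁` and `M₁₂` -/

namespace Witt12

/-- The Witt design `S(5, 6, 12)` on the points `0, …, 11`, with `11` for `∞`. -/
def design : SteinerSystem 5 6 12 (Fin 12) := witt12.congr pt.symm

/-- The characteristic number of a set of points. -/
def bits (B : Finset (Fin 12)) : ℕ := Nat.ofBits fun j : Fin 12 => decide (j ∈ B)

theorem testBit_bits (B : Finset (Fin 12)) (j : Fin 12) :
    (bits B).testBit j = decide (j ∈ B) := by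
  simp [bits, Nat.testBit_ofBits_lt]

theorem mem_design_blocks (B : Finset (Fin 12)) :
    B ∈ design.blocks ↔ hex (bits B) = true := by
  have h : bits B = mask (B.map pt.toEmbedding) := by
    simp [bits, mask]
  rw [h, ← mem_blocks_iff]
  rfl

/-- The image of a characteristic number under a permutation of the points. -/
def permBits (σ : Equiv.Perm (Fin 12)) (m : ℕ) : ℕ :=
  Nat.ofBits fun j : Fin 12 => Nat.testBit m (σ.symm j)

/-- Whether a permutation maps all hexads to hexads. -/
def preservesHexads (σ : Equiv.Perm (Fin 12)) : Bool :=
  (List.range 4096).all fun m => !hex m || strict hex (permBits σ m)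

theorem mem_aut_of_preservesHexads {σ : Equiv.Perm (Fin 12)} (h : preservesHexads σ = true) :
    σ ∈ design.aut := by
  refine SteinerSystem.mem_aut_of_map_mem fun B hB => ?_
  rw [mem_design_blocks] at hB ⊢
  have h1 := List.all_eq_true.1 h (bits B) (List.mem_range.2 (Nat.ofBits_lt_two_pow _))
  have h2 : permBits σ (bits B) = bits (B.map σ.toEmbedding) := by
    unfold permBits
    simp only [testBit_bits]
    simp [bits, Finset.mem_map_equiv]
  simpa [hB, strict_eq, h2] using h1

/-- A generator of order 4 of the pointwise stabilizer of `∞, 0, 1, 2`. -/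
def quarterI : Equiv.Perm (Fin 12) := permOfCycles [[3, 4, 9, 7], [5, 8, 6, 10]]

/-- Another generator of order 4 of the pointwise stabilizer of `∞, 0, 1, 2`. -/
def quarterJ : Equiv.Perm (Fin 12) := permOfCycles [[3, 5, 9, 6], [4, 10, 7, 8]]

theorem quarterI_mem : quarterI ∈ design.aut := mem_aut_of_preservesHexads (by decide +kernel)

theorem quarterJ_mem : quarterJ ∈ design.aut := mem_aut_of_preservesHexads (by decide +kernel)

/-- If `{y, z}` is the only pair that completes two given sets of four fixed points to hexads, then
it is invariant. -/
theorem apply_eq_or_eq {σ : Equiv.Perm (Fin 12)} (hσ : σ ∈ design.autThrough 11)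
    {a b c a' b' c' y z}
    (h₁ : {11, a, b, c, y, z} ∈ design.blocks) (h₂ : {11, a', b', c', y, z} ∈ design.blocks)
    (ha : σ a = a) (hb : σ b = b) (hc : σ c = c) (ha' : σ a' = a') (hb' : σ b' = b')
    (hc' : σ c' = c') (h : ∀ u w, {11, a, b, c, u, w} ∈ design.blocks →
      {11, a', b', c', u, w} ∈ design.blocks → u = y ∨ u = z) : σ y = y ∨ σ y = z := by
  refine h (σ y) (σ z) ?_ ?_
  · have := (hσ.2 _ (by simp)).2 h₁
    simpa [Finset.map_insert, hσ.1, ha, hb, hc] using this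
  · have := (hσ.2 _ (by simp)).2 h₂
    simpa [Finset.map_insert, hσ.1, ha', hb', hc'] using this

/-- The pointwise stabilizer of five points is trivial. -/
theorem eq_one_of_fixes {σ : Equiv.Perm (Fin 12)} (hσ : σ ∈ design.autThrough 11) (h0 : σ 0 = 0)
    (h1 : σ 1 = 1) (h2 : σ 2 = 2) (h3 : σ 3 = 3) : σ = 1 := by
  have h11 : σ 11 = 11 := hσ.1
  have h9 : σ 9 = 9 := by
    refine SteinerSystem.apply_eq_of_erase hσ (B := {11, 0, 1, 2, 3, 9})
      ((mem_design_blocks _).2 (by decide +kernel)) (by decide) (by decide) ?_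
    simpa [show ({11, 0, 1, 2, 3, 9} : Finset (Fin 12)).erase 9 = {11, 0, 1, 2, 3} by decide]
      using ⟨h11, h0, h1, h2, h3⟩
  -- The point 4 is the common point of two invariant pairs.
  have h4 : σ 4 = 4 := by
    have h47 : σ 4 = 4 ∨ σ 4 = 7 := by
      refine apply_eq_or_eq hσ (a := 0) (b := 1) (c := 2) (a' := 1) (b' := 3) (c' := 9) ?_ ?_
        h0 h1 h2 h1 h3 h9 ?_ <;>
      · simp only [mem_design_blocks]
        decide +kernel
    have h48 : σ 4 = 4 ∨ σ 4 = 8 := by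
      refine apply_eq_or_eq hσ (a := 0) (b := 1) (c := 3) (a' := 0) (b' := 2) (c' := 9) ?_ ?_
        h0 h1 h3 h0 h2 h9 ?_ <;>
      · simp only [mem_design_blocks]
        decide +kernel
    rcases h47 with h | h
    · exact h
    · rcases h48 with h' | h' <;> rw [h] at h' <;> exact absurd h' (by decide)
  have h7 : σ 7 = 7 := by
    refine SteinerSystem.apply_eq_of_erase hσ (B := {11, 0, 1, 2, 4, 7})
      ((mem_design_blocks _).2 (by decide +kernel)) (by decide) (by decide) ?_
    simpa [show ({11, 0, 1, 2, 4, 7} : Finset (Fin 12)).erase 7 = {11, 0, 1, 2, 4} by decide]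
      using ⟨h11, h0, h1, h2, h4⟩
  have h8 : σ 8 = 8 := by
    refine SteinerSystem.apply_eq_of_erase hσ (B := {11, 0, 1, 3, 4, 8})
      ((mem_design_blocks _).2 (by decide +kernel)) (by decide) (by decide) ?_
    simpa [show ({11, 0, 1, 3, 4, 8} : Finset (Fin 12)).erase 8 = {11, 0, 1, 3, 4} by decide]
      using ⟨h11, h0, h1, h3, h4⟩
  have h6 : σ 6 = 6 := by
    refine SteinerSystem.apply_eq_of_erase hσ (B := {11, 0, 1, 9, 4, 6})
      ((mem_design_blocks _).2 (by decide +kernel)) (by decide) (by decide) ?_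
    simpa [show ({11, 0, 1, 9, 4, 6} : Finset (Fin 12)).erase 6 = {11, 0, 1, 9, 4} by decide]
      using ⟨h11, h0, h1, h9, h4⟩
  have h5 : σ 5 = 5 := by
    refine SteinerSystem.apply_eq_of_erase hσ (B := {11, 0, 2, 3, 4, 5})
      ((mem_design_blocks _).2 (by decide +kernel)) (by decide) (by decide) ?_
    simpa [show ({11, 0, 2, 3, 4, 5} : Finset (Fin 12)).erase 5 = {11, 0, 2, 3, 4} by decide]
      using ⟨h11, h0, h2, h3, h4⟩
  have h10 : σ 10 = 10 := by
    refine SteinerSystem.apply_eq_of_erase hσ (B := {11, 0, 3, 9, 4, 10})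
      ((mem_design_blocks _).2 (by decide +kernel)) (by decide) (by decide) ?_
    simpa [show ({11, 0, 3, 9, 4, 10} : Finset (Fin 12)).erase 10 = {11, 0, 3, 9, 4} by decide]
      using ⟨h11, h0, h3, h9, h4⟩
  ext x
  fin_cases x <;> simp [*]

variable {G : Subgroup (Equiv.Perm (Fin 12))}

/-- The pointwise stabilizer of four points is regular on the remaining eight points, so that it is
a group of order 8. -/
theorem mixableTransitive_four (hlo : design.aut ⊓ stabilizer _ (11 : Fin 12) ≤ G)
    (hhi : G ≤ design.autThrough 11) :
    MixableTransitive (G ⊓ stabilizer _ (0 : Fin 12) ⊓ stabilizer _ (1 : Fin 12) ⊓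
      stabilizer _ (2 : Fin 12)) {2, 1, 0, 11} := by
  set K := G ⊓ stabilizer _ (0 : Fin 12) ⊓ stabilizer _ (1 : Fin 12) ⊓ stabilizer _ (2 : Fin 12)
    with hK
  have hfix : ∀ σ ∈ K, ∀ x ∈ ({2, 1, 0, 11} : Set (Fin 12)), σ x = x := by
    rintro σ ⟨⟨⟨hG, h0⟩, h1⟩, h2⟩ x (rfl | rfl | rfl | rfl)
    exacts [h2, h1, h0, (hhi hG).1]
  have hword : ∀ a b : ℕ, quarterI ^ a * quarterJ ^ b ∈ K := by
    have hI : quarterI ∈ K := ⟨⟨⟨hlo ⟨quarterI_mem, mem_stabilizer_iff.2 (by decide)⟩,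
      mem_stabilizer_iff.2 (by decide)⟩, mem_stabilizer_iff.2 (by decide)⟩,
      mem_stabilizer_iff.2 (by decide)⟩
    have hJ : quarterJ ∈ K := ⟨⟨⟨hlo ⟨quarterJ_mem, mem_stabilizer_iff.2 (by decide)⟩,
      mem_stabilizer_iff.2 (by decide)⟩, mem_stabilizer_iff.2 (by decide)⟩,
      mem_stabilizer_iff.2 (by decide)⟩
    exact fun a b => mul_mem (pow_mem hI a) (pow_mem hJ b)
  have hreach : ∀ y ∉ ({2, 1, 0, 11} : Set (Fin 12)), ∃ σ ∈ K, σ 3 = y := by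
    intro y hy
    have : ∀ y : Fin 12, y = 2 ∨ y = 1 ∨ y = 0 ∨ y = 11 ∨
        ∃ a b : Fin 4, (quarterI ^ (a : ℕ) * quarterJ ^ (b : ℕ)) 3 = y := by decide +kernel
    simp only [Set.mem_insert_iff, Set.mem_singleton_iff, not_or] at hy
    obtain ⟨a, b, hab⟩ : ∃ a b : Fin 4, (quarterI ^ (a : ℕ) * quarterJ ^ (b : ℕ)) 3 = y := by
      have := this y
      tauto
    exact ⟨_, hword a b, hab⟩
  refine ⟨?_, hfix, fun x hx y hy => ?_⟩
  · refine IsMixable.of_card_eq_two_pow 3 _ ?_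
    rw [card_eq_card_mul_card_stabilizer (x := 3) (S := {3, 4, 5, 6, 7, 8, 9, 10})]
    · have : K ⊓ stabilizer _ (3 : Fin 12) = ⊥ := by
        rw [eq_bot_iff]
        rintro σ ⟨⟨⟨⟨hG, h0⟩, h1⟩, h2⟩, h3⟩
        exact eq_one_of_fixes (hhi hG) h0 h1 h2 h3
      rw [this, Subgroup.card_bot]
      rfl
    · intro σ hσ
      have h := Equiv.Perm.apply_notMem_of_fixes (hfix σ hσ) (x := 3) (by simp)
      generalize σ 3 = y at h
      revert y
      simp only [Set.mem_insert_iff, Set.mem_singleton_iff]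
      decide
    · intro y hy
      refine hreach y ?_
      revert y
      simp only [Set.mem_insert_iff, Set.mem_singleton_iff]
      decide
  · obtain ⟨σ, hσ, rfl⟩ := hreach x hx
    obtain ⟨τ, hτ, rfl⟩ := hreach y hy
    exact ⟨τ * σ⁻¹, mul_mem hτ (inv_mem hσ), by simp⟩

/-- Both `M₁₁` and the stabilizer of `∞` in `M₁₂` qualify for `G`. -/
theorem mixableTransitive_one (hlo : design.aut ⊓ stabilizer _ (11 : Fin 12) ≤ G)
    (hhi : G ≤ design.autThrough 11) : MixableTransitive G {11} := by
  have h4 := mixableTransitive_four hlo hhi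
  have h3 : MixableTransitive (G ⊓ stabilizer _ (0 : Fin 12) ⊓ stabilizer _ (1 : Fin 12))
      {1, 0, 11} := by
    refine h4.of_stabilizer ?_ ?_
    · rintro σ ⟨⟨hG, h0⟩, h1⟩ x (rfl | rfl | rfl)
      exacts [h1, h0, (hhi hG).1]
    · refine ⟨permOfCycles [[2, 3], [4, 6], [5, 8], [7, 10]], ⟨⟨hlo ⟨?_, ?_⟩, ?_⟩, ?_⟩, ?_⟩
      · exact mem_aut_of_preservesHexads (by decide +kernel)
      exacts [mem_stabilizer_iff.2 (by decide), mem_stabilizer_iff.2 (by decide),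
        mem_stabilizer_iff.2 (by decide), by decide]
  have h2 : MixableTransitive (G ⊓ stabilizer _ (0 : Fin 12)) {0, 11} := by
    refine h3.of_stabilizer ?_ ?_
    · rintro σ ⟨hG, h0⟩ x (rfl | rfl)
      exacts [h0, (hhi hG).1]
    · refine ⟨permOfCycles [[1, 2], [4, 10], [5, 6], [7, 8]], ⟨hlo ⟨?_, ?_⟩, ?_⟩, ?_⟩
      · exact mem_aut_of_preservesHexads (by decide +kernel)
      exacts [mem_stabilizer_iff.2 (by decide), mem_stabilizer_iff.2 (by decide), by decide]
  refine h2.of_stabilizer ?_ ?_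
  · rintro σ hG x rfl
    exact (hhi hG).1
  · refine ⟨permOfCycles [[0, 1], [4, 6], [5, 7], [8, 10]], hlo ⟨?_, ?_⟩, ?_⟩
    · exact mem_aut_of_preservesHexads (by decide +kernel)
    exacts [mem_stabilizer_iff.2 (by decide), by decide]

theorem isMixable_aut : IsMixable design.aut := by
  have h := mixableTransitive_one le_rfl (design.aut_inf_stabilizer_le_autThrough 11)
  refine (MixableTransitive.of_stabilizer (F := ∅) (x := 11) (by simpa using h) (by simp)
    ⟨permOfCycles [[0, 11], [4, 8], [5, 6], [7, 10]], ?_, ?_⟩).isMixable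
  · exact mem_aut_of_preservesHexads (by decide +kernel)
  · decide

end Witt12

theorem mixable_mathieu12 : Mixable mathieu12 := by
  refine mixable_of_isMixable_range
    (Witt12.pt.symm.permCongrHom.toMonoidHom.comp mathieu12.subtype)
    (Witt12.pt.symm.permCongrHom.injective.comp mathieu12.subtype_injective) ?_
  rw [MonoidHom.range_comp, Subgroup.range_subtype, mathieu12, SteinerSystem.map_aut]
  exact Witt12.isMixable_aut

theorem mixable_mathieu11 : Mixable mathieu11 := by
  refine mixable_of_isMixable_range (Witt12.pt.symm.permCongrHom.toMonoidHom.comp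
    (Equiv.Perm.ofSubtype.comp mathieu11.subtype))
    (Witt12.pt.symm.permCongrHom.injective.comp
      (Equiv.Perm.ofSubtype_injective.comp mathieu11.subtype_injective)) ?_
  rw [MonoidHom.range_comp, mathieu11, SteinerSystem.range_derived_aut,
    SteinerSystem.map_autThrough]
  exact (Witt12.mixableTransitive_one
    (Witt12.design.aut_inf_stabilizer_le_autThrough 11) le_rfl).isMixable

/-! ### The Golay code and its automorphisms -/

namespace Witt24

/-- The Witt design `S(5, 8, 24)` on the points `0, …, 23`, with `23` for `∞`. -/
def design : SteinerSystem 5 8 24 (Fin 24) := witt24.congr pt.symm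

/-- The columns of a generator matrix `(I | *)` of the extended Golay code, as binary numbers. -/
def systematicCols : List ℕ :=
  [1, 2, 4, 8, 16, 32, 64, 128, 256, 512, 1024, 2048, 1183, 2366, 1763, 3526, 3859, 2745, 493,
    986, 1972, 3944, 2639, 3189]

/-- The entries of the generator matrix. -/
def systematic (a : Fin 24) (l : Fin 12) : ZMod 2 :=
  if (systematicCols.getD a 0).testBit l then 1 else 0

/-- For each row of the generator matrix, the number whose digit `j < 11` says whether the `j`-th
translate of the squares occurs in its expression as a symmetric difference of the first 11
translates and possibly the set of all points; the digit 11 is for the latter. -/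
def systematicRels : List ℕ :=
  [3753, 280, 3225, 1400, 3770, 3991, 3533, 2000, 1347, 101, 3683, 3621]

theorem systematic_eq_sum (a : Fin 24) (l : Fin 12) :
    systematic a l = (∑ j : Fin 11, if (systematicRels.getD l 0).testBit j then
      (((cols.getD a 0).testBit j).toNat : ZMod 2) else 0) +
      (((systematicRels.getD l 0).testBit 11).toNat : ZMod 2) := by
  revert a l
  decide +kernel

theorem cols_eq_sum (a : Fin 24) (j : Fin 11) :
    (((cols.getD a 0).testBit j).toNat : ZMod 2) =
      ∑ l : Fin 12, (((cols.getD l 0).testBit j).toNat : ZMod 2) * systematic a l := by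
  revert a j
  decide +kernel

theorem mem_design_blocks (B : Finset (Fin 24)) :
    B ∈ design.blocks ↔ B.card = 8 ∧ ∀ l, ∑ a ∈ B, systematic a l = 0 := by
  have hpar : ∀ j : Fin 11, par (B.map pt.toEmbedding) ((j : ℕ) : ZMod 23) =
      ∑ a ∈ B, (((cols.getD a 0).testBit j).toNat : ZMod 2) := by
    intro j
    rw [par, Finset.sum_map]
    exact Finset.sum_congr rfl fun a _ => inc_pt j a
  have h : B ∈ design.blocks ↔ (B.map pt.toEmbedding) ∈ wittBlocks24 := Iff.rfl
  rw [h, mem_blocks_iff, Finset.card_map]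
  refine and_congr_right fun hB => ⟨fun hz l => ?_, fun hz i => ?_⟩
  · simp only [systematic_eq_sum, Finset.sum_add_distrib]
    rw [Finset.sum_comm, Finset.sum_const, hB, Finset.sum_eq_zero]
    · rw [zero_add, nsmul_eq_mul]
      have : ((8 : ℕ) : ZMod 2) = 0 := by decide
      rw [this, zero_mul]
    · intro j _
      split_ifs
      · rw [← hpar, hz]
      · simp
  · have : par (∅ : Finset (Option (ZMod 23))) i = 0 := by simp [par]
    rw [← this]
    refine par_ext (fun j => ?_) i
    have : par (∅ : Finset (Option (ZMod 23))) ((j : ℕ) : ZMod 23) = 0 := by simp [par]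
    rw [this, hpar]
    simp only [fun a => cols_eq_sum a j]
    rw [Finset.sum_comm]
    simp only [← Finset.mul_sum, hz, mul_zero, Finset.sum_const_zero]

/-- Whether a permutation of the points preserves the Golay code: whether it acts linearly on the
columns of the generator matrix, the first 12 of which are the standard basis. -/
def PreservesCode (σ : Equiv.Perm (Fin 24)) : Prop :=
  ∀ (a : Fin 24) (l : Fin 12), systematic (σ a) l =
    ∑ m : Fin 12, systematic a m * systematic (σ (m.castLE (by norm_num))) l

instance (σ : Equiv.Perm (Fin 24)) : Decidable (PreservesCode σ) :=
  inferInstanceAs (Decidable (∀ (a : Fin 24) (l : Fin 12), systematic (σ a) l =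
    ∑ m : Fin 12, systematic a m * systematic (σ (m.castLE (by norm_num))) l))

theorem mem_aut_of_preservesCode {σ : Equiv.Perm (Fin 24)} (h : PreservesCode σ) :
    σ ∈ design.aut := by
  refine SteinerSystem.mem_aut_of_map_mem fun B hB => ?_
  rw [mem_design_blocks] at hB ⊢
  refine ⟨by rw [Finset.card_map, hB.1], fun l => ?_⟩
  rw [Finset.sum_map]
  change ∑ a ∈ B, systematic (σ a) l = 0
  rw [Finset.sum_congr rfl fun a _ => h a l, Finset.sum_comm]
  simp only [← Finset.sum_mul, hB.2, zero_mul, Finset.sum_const_zero]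

/-! ### The sextet of four points and the group `2⁴ : A₅` -/

/-- The number of the tetrad of a point, in the sextet of `{∞, 0, 1, 2}`: the points are divided
into six tetrads, any two of which form an octad. The tetrad `{∞, 0, 1, 2}` has the number 5. -/
def tetrad : Fin 24 → Fin 6 :=
  ![5, 5, 5, 0, 4, 0, 3, 3, 1, 2, 2, 1, 1, 4, 0, 2, 4, 0, 1, 3, 2, 3, 4, 5]

/-- The union of a tetrad with the tetrad `{∞, 0, 1, 2}`. -/
def tetradOctad (i : Fin 6) : Finset (Fin 24) :=
  Finset.univ.filter fun x => tetrad x = i ∨ tetrad x = 5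

theorem tetradOctad_mem {i : Fin 6} (hi : i ≠ 5) : tetradOctad i ∈ design.blocks := by
  rw [mem_design_blocks]
  revert i
  decide +kernel

/-- The colouring of the tetrads with class sizes 2, 1, 2, and a further colour for
`{∞, 0, 1, 2}`. -/
def tetradColor : Fin 6 → ℕ := ![0, 0, 1, 2, 2, 3]

/-- A point in each tetrad other than `{∞, 0, 1, 2}`. -/
def representative : Fin 5 → Fin 24 := ![3, 8, 9, 6, 4]

/-- Involutions that fix `∞, 0, 1, 2`. They act on the numbers of the tetrads as `(0 1)(3 4)`,
`(0 1)(2 4)`, `(1 2)(3 4)` and `(0 3)(1 4)`. -/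
def tetradInvolution : Fin 4 → Equiv.Perm (Fin 24) :=
  ![permOfCycles [[3, 8], [4, 21], [5, 12], [6, 13], [7, 22], [11, 17], [14, 18], [16, 19]],
    permOfCycles [[3, 8], [4, 9], [5, 18], [10, 13], [11, 14], [12, 17], [15, 16], [20, 22]],
    permOfCycles [[4, 6], [7, 22], [8, 20], [9, 12], [10, 11], [13, 19], [15, 18], [16, 21]],
    permOfCycles [[3, 6], [4, 18], [5, 19], [7, 17], [8, 13], [11, 22], [12, 16], [14, 21]]]

/-- The action of the involutions on the colourings of the five tetrads. -/
def coloringAction : Fin 4 → ℕ × ℕ × ℕ × ℕ × ℕ → ℕ × ℕ × ℕ × ℕ × ℕ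
  | 0, (a, b, c, d, e) => (b, a, c, e, d)
  | 1, (a, b, c, d, e) => (b, a, e, d, c)
  | 2, (a, b, c, d, e) => (a, c, b, e, d)
  | 3, (a, b, c, d, e) => (d, e, c, a, b)

/-- A walk on the 30 colourings with class sizes 2, 1, 2, the last step first. The steps with the
first two involutions average over the group `S₃` that they generate, the stabilizer in `A₅` of the
pair `{0, 1}` of tetrads. Between them, a step with probability `3/5` to a disjoint pair and one
with probability `3/4` to a pair that shares a tetrad with `{0, 1}` annihilate the two nontrivial
eigenspaces of the Petersen graph on the 10 pairs. -/
def coloringWalk : List (Fin 4 × ℚ) :=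
  [(0, 1 / 2), (1, 2 / 3), (0, 1 / 2), (2, 3 / 4), (0, 1 / 2), (1, 2 / 3), (3, 3 / 5), (0, 1 / 2),
    (1, 2 / 3)]

theorem walkProb_of_count : ∀ a b c d e : Fin 3, [a, b, c, d, e].count 0 = 2 →
    [a, b, c, d, e].count 1 = 1 → [a, b, c, d, e].count 2 = 2 →
    walkProb coloringAction (0, 0, 1, 2, 2) coloringWalk
      (a.val, b.val, c.val, d.val, e.val) = 1 / 30 := by
  decide +kernel

theorem walkProb_coloringWalk (e : Equiv.Perm (Fin 5)) :
    walkProb coloringAction (0, 0, 1, 2, 2) coloringWalk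
      (tetradColor (e 0).castSucc, tetradColor (e 1).castSucc, tetradColor (e 2).castSucc,
        tetradColor (e 3).castSucc, tetradColor (e 4).castSucc) = 1 / 30 := by
  have hcol : ∀ j : Fin 5, tetradColor j.castSucc = ((![0, 0, 1, 2, 2] j : Fin 3) : ℕ) := by
    decide
  have hcount : ∀ (e : Equiv.Perm (Fin 5)) (i : Fin 3),
      [![0, 0, 1, 2, 2] (e 0), ![0, 0, 1, 2, 2] (e 1), ![0, 0, 1, 2, 2] (e 2),
        ![0, 0, 1, 2, 2] (e 3), ![0, 0, 1, 2, 2] (e 4)].count i = ![2, 1, 2] i := by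
    decide +kernel
  simp only [hcol]
  exact walkProb_of_count _ _ _ _ _ (hcount e 0) (hcount e 1) (hcount e 2)

theorem tetradInvolution_mem (i : Fin 4) : tetradInvolution i ∈ design.aut := by
  refine mem_aut_of_preservesCode ?_
  revert i
  decide +kernel

/-- Automorphisms that preserve all six tetrads: the first two fix the tetrad number 0 pointwise,
the other two the tetrad number 2. -/
def tetradTranslation : Fin 4 → Equiv.Perm (Fin 24) :=
  ![permOfCycles [[4, 13], [6, 19], [7, 21], [8, 11], [9, 15], [10, 20], [12, 18], [16, 22]],
    permOfCycles [[4, 16], [6, 21], [7, 19], [8, 12], [9, 20], [10, 15], [11, 18], [13, 22]],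
    permOfCycles [[3, 5], [4, 22], [6, 19], [7, 21], [8, 12], [11, 18], [13, 16], [14, 17]],
    permOfCycles [[3, 14], [4, 13], [5, 17], [6, 21], [7, 19], [8, 18], [11, 12], [16, 22]]]

theorem tetradTranslation_mem (i : Fin 4) : tetradTranslation i ∈ design.aut := by
  refine mem_aut_of_preservesCode ?_
  revert i
  decide +kernel

theorem toFinset_mem_design_blocks {B : List (Fin 24)} (hB : B.Nodup) (h8 : B.length = 8)
    (hsum : ∀ l, (B.map fun a => systematic a l).sum = 0) : B.toFinset ∈ design.blocks := by
  rw [mem_design_blocks]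
  refine ⟨by rw [List.toFinset_card_of_nodup hB, h8], fun l => ?_⟩
  rw [List.sum_toFinset _ hB, hsum]

/-- A point is fixed if it is separated from all others by the invariant sets that are at hand: an
invariant set `C`, the set `F` of known fixed points, and octads through `∞` with at least five
points in `F`. -/
theorem apply_eq_of_separated {σ : Equiv.Perm (Fin 24)} (hσ : σ ∈ design.autThrough 23)
    {F : List (Fin 24)} (hF : ∀ x ∈ F, σ x = x) {C : Fin 24 → Prop}
    (hC : ∀ y, C (σ y) ↔ C y) {L : List (List (Fin 24))}
    (hL : ∀ B ∈ L, (B.Nodup ∧ B.length = 8 ∧ ∀ l, (B.map fun a => systematic a l).sum = 0) ∧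
      23 ∈ B ∧ 5 ≤ (B.filter (· ∈ F)).length)
    {x : Fin 24} (hsep : ∀ y, y ∉ F → (C y ↔ C x) → (∀ B ∈ L, y ∈ B ↔ x ∈ B) → y = x) :
    σ x = x := by
  by_cases hx : x ∈ F
  · exact hF x hx
  refine hsep _ (fun h => hx (by rwa [← σ.injective (hF _ h)])) (hC x) fun B hB => ?_
  obtain ⟨⟨hnd, h8, hsum⟩, h23, h5⟩ := hL B hB
  rw [← List.toFinset_card_of_nodup (hnd.filter _)] at h5
  obtain ⟨T, hT, hT5⟩ := Finset.exists_subset_card_eq h5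
  have hmem : ∀ y ∈ T, y ∈ B ∧ y ∈ F := fun y hy => by simpa using hT hy
  have h := SteinerSystem.apply_mem_block_iff hσ (toFinset_mem_design_blocks hnd h8 hsum)
    (List.mem_toFinset.2 h23) (fun y hy => List.mem_toFinset.2 (hmem y hy).1) hT5
    (fun y hy => hF y (hmem y hy).2) x
  simpa using h

/-- An automorphism that fixes `∞, 0, 1, 2`, one point of the tetrad number 2 and one of the tetrad
number 0, and preserves the union of the tetrads number 0 and 1, is trivial: the tetrad number 1 is
fixed pointwise, and then all points are fixed. -/
theorem eq_one_of_fixes {σ : Equiv.Perm (Fin 24)} (hσ : σ ∈ design.autThrough 23)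
    (hF : ∀ x ∈ ([23, 0, 1, 2, 9, 3] : List (Fin 24)), σ x = x)
    (hC : ∀ y, tetradColor (tetrad (σ y)) = 0 ↔ tetradColor (tetrad y) = 0) : σ = 1 := by
  have h1 : ∀ x ∈ ([8, 11, 12, 18] : List (Fin 24)), σ x = x := by
    have hsep : ∀ x ∈ ([8, 11, 12, 18] : List (Fin 24)), ∀ y : Fin 24, y ∉ [23, 0, 1, 2, 9, 3] →
        (tetradColor (tetrad y) = 0 ↔ tetradColor (tetrad x) = 0) →
        (∀ B ∈ [[0, 1, 2, 3, 5, 14, 17, 23], [0, 1, 3, 7, 9, 16, 18, 23],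
          [1, 2, 3, 9, 12, 13, 19, 23], [0, 2, 3, 4, 8, 9, 21, 23]], y ∈ B ↔ x ∈ B) → y = x := by
      decide +kernel
    exact fun x hx => apply_eq_of_separated (C := fun y => tetradColor (tetrad y) = 0) hσ hF hC
      (by decide +kernel) (hsep x hx)
  have h2 : ∀ x ∈ ([23, 0, 1, 2, 9, 3] ++ [8, 11, 12, 18] : List (Fin 24)), σ x = x := by
    intro x hx
    rcases List.mem_append.1 hx with h | h
    exacts [hF x h, h1 x h]
  have hsep : ∀ x : Fin 24, x ∈ [23, 0, 1, 2, 9, 3] ++ [8, 11, 12, 18] ∨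
      ∀ y : Fin 24, y ∉ [23, 0, 1, 2, 9, 3] ++ [8, 11, 12, 18] → (True ↔ True) →
      (∀ B ∈ [[0, 2, 3, 6, 12, 16, 20, 23], [0, 1, 3, 4, 11, 19, 20, 23],
        [3, 11, 12, 15, 16, 18, 19, 23], [0, 1, 2, 3, 5, 14, 17, 23],
        [1, 2, 9, 17, 18, 21, 22, 23], [0, 1, 5, 9, 11, 13, 21, 23],
        [1, 2, 4, 7, 9, 11, 14, 23]], y ∈ B ↔ x ∈ B) → y = x := by
    decide +kernel
  ext1 x
  rcases hsep x with h | h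
  · exact h2 x h
  · exact apply_eq_of_separated (C := fun _ => True) hσ h2 (fun _ => Iff.rfl)
      (by decide +kernel) h

/-- The automorphisms that fix `∞, 0, 1, 2` permute the other tetrads. -/
theorem tetrad_apply_eq {σ : Equiv.Perm (Fin 24)} (hσ : σ ∈ design.autThrough 23)
    (hfix : ∀ x, tetrad x = 5 → σ x = x) {x y : Fin 24} (hxy : tetrad x = tetrad y) :
    tetrad (σ x) = tetrad (σ y) := by
  by_cases hx : tetrad x = 5
  · rw [hfix x hx, hfix y (hxy ▸ hx), hxy]
  have hout : ∀ z, tetrad z ≠ 5 → tetrad (σ z) ≠ 5 := fun z hz h => hz (by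
    rwa [σ.injective (hfix _ h)] at h)
  set T : Finset (Fin 24) := insert (σ x) {23, 0, 1, 2} with hT
  have hT0 : ∀ z ∈ ({23, 0, 1, 2} : Finset (Fin 24)), tetrad z = 5 := by decide
  have h1 : (tetradOctad (tetrad x)).map σ.toEmbedding ∈ design.blocks :=
    (hσ.2 _ (by simp [tetradOctad, hT0 23 (by decide)])).2 (tetradOctad_mem hx)
  have h2 := tetradOctad_mem (hout x hx)
  have h3 : (tetradOctad (tetrad x)).map σ.toEmbedding = tetradOctad (tetrad (σ x)) := by
    refine SteinerSystem.block_eq_of_subset h1 h2 (T := T) ?_ ?_ ?_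
    · rw [hT, Finset.card_insert_of_notMem fun h => hout x hx (hT0 _ h)]
      rfl
    · intro z hz
      rcases Finset.mem_insert.1 hz with rfl | hz
      · exact Finset.mem_map_of_mem σ.toEmbedding (by simp [tetradOctad])
      · exact Finset.mem_map.2 ⟨z, by simp [tetradOctad, hT0 z hz], hfix z (hT0 z hz)⟩
    · intro z hz
      rcases Finset.mem_insert.1 hz with rfl | hz
      · simp [tetradOctad]
      · simp [tetradOctad, hT0 z hz]
  have h4 : σ y ∈ (tetradOctad (tetrad x)).map σ.toEmbedding :=
    Finset.mem_map_of_mem σ.toEmbedding (by simp [tetradOctad, hxy])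
  rw [h3] at h4
  have h5 := (Finset.mem_filter.1 h4).2
  rw [or_iff_left (hout y (hxy ▸ hx))] at h5
  exact h5.symm

/-- The permutations that preserve the colours of all points. -/
def colorGroup : Subgroup (Equiv.Perm (Fin 24)) where
  carrier := {σ | ∀ x, tetradColor (tetrad (σ x)) = tetradColor (tetrad x)}
  one_mem' := fun _ => rfl
  mul_mem' := fun {σ τ} hσ hτ x => (hσ (τ x)).trans (hτ x)
  inv_mem' := fun {σ} hσ x => by
    have h := hσ (σ⁻¹ x)
    rw [show σ (σ⁻¹ x) = x from σ.apply_symm_apply x] at h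
    exact h.symm

variable {G : Subgroup (Equiv.Perm (Fin 24))}

/-- The subgroup of `G` that fixes `0, 1, 2`. If `G` is between the stabilizer of `∞` in `M₂₄` and
`M₂₃`, this is a group `2⁴ : A₅`. -/
def fixFour (G : Subgroup (Equiv.Perm (Fin 24))) : Subgroup (Equiv.Perm (Fin 24)) :=
  G ⊓ stabilizer _ (0 : Fin 24) ⊓ stabilizer _ (1 : Fin 24) ⊓ stabilizer _ (2 : Fin 24)

theorem mem_fixFour (hlo : design.aut ⊓ stabilizer _ (23 : Fin 24) ≤ G) {σ : Equiv.Perm (Fin 24)}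
    (hσ : σ ∈ design.aut) (h : ∀ x, tetrad x = 5 → σ x = x) : σ ∈ fixFour G :=
  ⟨⟨⟨hlo ⟨hσ, h 23 (by decide)⟩, h 0 (by decide)⟩, h 1 (by decide)⟩, h 2 (by decide)⟩

theorem apply_eq_of_mem_fixFour (hhi : G ≤ design.autThrough 23) {σ : Equiv.Perm (Fin 24)}
    (hσ : σ ∈ fixFour G) : ∀ x, tetrad x = 5 → σ x = x := by
  obtain ⟨⟨⟨hG, h0⟩, h1⟩, h2⟩ := hσ
  intro x hx
  have : ∀ x, tetrad x = 5 → x = 0 ∨ x = 1 ∨ x = 2 ∨ x = 23 := by decide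
  rcases this x hx with rfl | rfl | rfl | rfl
  exacts [h0, h1, h2, (hhi hG).1]

theorem tetradInvolution_mem_fixFour (hlo : design.aut ⊓ stabilizer _ (23 : Fin 24) ≤ G)
    (i : Fin 4) : tetradInvolution i ∈ fixFour G := by
  refine mem_fixFour hlo (tetradInvolution_mem i) ?_
  revert i
  decide +kernel

theorem tetradTranslation_mem_fixFour (hlo : design.aut ⊓ stabilizer _ (23 : Fin 24) ≤ G)
    (i : Fin 4) : tetradTranslation i ∈ fixFour G := by
  refine mem_fixFour hlo (tetradTranslation_mem i) ?_
  revert i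
  decide +kernel

/-- The stabilizer of a colouring in `2⁴ : A₅` has order 32: it is transitive on the tetrad number
2, the stabilizer of one of its points is regular on the union of the tetrads number 0 and 1. -/
theorem isMixable_inf_colorGroup (hlo : design.aut ⊓ stabilizer _ (23 : Fin 24) ≤ G)
    (hhi : G ≤ design.autThrough 23) : IsMixable (fixFour G ⊓ colorGroup) := by
  have htrans : ∀ i, tetradTranslation i ∈ fixFour G ⊓ colorGroup := fun i =>
    ⟨tetradTranslation_mem_fixFour hlo i, by
      change ∀ x, _
      revert i
      decide +kernel⟩
  have hinv : tetradInvolution 0 ∈ fixFour G ⊓ colorGroup :=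
    ⟨tetradInvolution_mem_fixFour hlo 0, by
      change ∀ x, _
      decide +kernel⟩
  have hcol : ∀ {σ}, σ ∈ fixFour G ⊓ colorGroup → ∀ x,
    tetradColor (tetrad (σ x)) = tetradColor (tetrad x) := fun h => h.2
  refine IsMixable.of_card_eq_two_pow 5 _ ?_
  rw [card_eq_card_mul_card_stabilizer (x := 9) (S := {9, 10, 15, 20}),
    card_eq_card_mul_card_stabilizer (x := 3) (S := {3, 5, 14, 17, 8, 11, 12, 18})]
  · have : fixFour G ⊓ colorGroup ⊓ stabilizer _ (9 : Fin 24) ⊓ stabilizer _ (3 : Fin 24) = ⊥ := by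
      rw [eq_bot_iff]
      rintro σ ⟨⟨⟨hσ, hc⟩, h9⟩, h3⟩
      obtain ⟨⟨⟨hG, h0⟩, h1⟩, h2⟩ := id hσ
      refine eq_one_of_fixes (hhi hG) ?_ fun y => by rw [hc y]
      simp only [List.mem_cons, List.not_mem_nil, or_false]
      rintro x (rfl | rfl | rfl | rfl | rfl | rfl)
      exacts [(hhi hG).1, h0, h1, h2, h9, h3]
    rw [this, Subgroup.card_bot]
    rfl
  · rintro σ ⟨hσ, -⟩
    have h := hcol hσ 3
    generalize σ 3 = y at h
    revert y
    decide +kernel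
  · intro y hy
    have : ∀ y ∈ ({3, 5, 14, 17, 8, 11, 12, 18} : Finset (Fin 24)), ∃ a b c : Fin 2,
        (tetradTranslation 2 ^ (a : ℕ) * tetradTranslation 3 ^ (b : ℕ) *
          tetradInvolution 0 ^ (c : ℕ)) 3 = y ∧
        (tetradTranslation 2 ^ (a : ℕ) * tetradTranslation 3 ^ (b : ℕ) *
          tetradInvolution 0 ^ (c : ℕ)) 9 = 9 := by
      decide +kernel
    obtain ⟨a, b, c, habc, h9⟩ := this y hy
    exact ⟨_, ⟨mul_mem (mul_mem (pow_mem (htrans 2) _) (pow_mem (htrans 3) _)) (pow_mem hinv _),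
      h9⟩, habc⟩
  · intro σ hσ
    have h := hcol hσ 9
    generalize σ 9 = y at h
    revert y
    decide +kernel
  · intro y hy
    have : ∀ y ∈ ({9, 10, 15, 20} : Finset (Fin 24)), ∃ a b : Fin 2,
        (tetradTranslation 0 ^ (a : ℕ) * tetradTranslation 1 ^ (b : ℕ)) 9 = y := by
      decide +kernel
    obtain ⟨a, b, hab⟩ := this y hy
    exact ⟨_, mul_mem (pow_mem (htrans 0) _) (pow_mem (htrans 1) _), hab⟩

/-- The group `2⁴ : A₅` is mixable, from its action on the 30 colourings of the tetrads. -/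
theorem isMixable_fixFour (hlo : design.aut ⊓ stabilizer _ (23 : Fin 24) ≤ G)
    (hhi : G ≤ design.autThrough 23) : IsMixable (fixFour G) := by
  have hG : ∀ {σ}, σ ∈ fixFour G → σ ∈ design.autThrough 23 := fun h => hhi h.1.1.1
  have htet : ∀ {σ}, σ ∈ fixFour G → ∀ {x y}, tetrad x = tetrad y → tetrad (σ x) = tetrad (σ y) :=
    fun h => tetrad_apply_eq (hG h) (apply_eq_of_mem_fixFour hhi h)
  have hrep : ∀ x, tetrad x = 5 ∨ ∃ j, tetrad x = tetrad (representative j) := by decide +kernel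
  refine IsMixable.of_walkProb inf_le_left (isMixable_inf_colorGroup hlo hhi)
    (fun σ => (tetradColor (tetrad (σ 3)), tetradColor (tetrad (σ 8)), tetradColor (tetrad (σ 9)),
      tetradColor (tetrad (σ 6)), tetradColor (tetrad (σ 4))))
    (fun z hz => ⟨fun h => ⟨hz, fun x => ?_⟩, fun h => ?_⟩) tetradInvolution
    (tetradInvolution_mem_fixFour hlo) coloringAction (fun i z hz => ?_) coloringWalk
    (by simp only [coloringWalk]; norm_num) (c := 1 / 30) fun z hz => ?_
  · rcases hrep x with hx | ⟨j, hj⟩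
    · rw [apply_eq_of_mem_fixFour hhi hz x hx]
    · rw [htet hz hj, hj]
      simp only [Prod.mk.injEq] at h
      obtain ⟨h0, h1, h2, h3, h4⟩ := h
      fin_cases j
      exacts [h0, h1, h2, h3, h4]
  · simp only [Prod.mk.injEq]
    exact ⟨h.2 3, h.2 8, h.2 9, h.2 6, h.2 4⟩
  · have key : ∀ {x y}, tetrad ((tetradInvolution i)⁻¹ x) = tetrad y →
        tetradColor (tetrad ((z * (tetradInvolution i)⁻¹) x)) = tetradColor (tetrad (z y)) :=
      fun h => by rw [Equiv.Perm.mul_apply, htet hz h]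
    fin_cases i <;> simp only [coloringAction, Prod.mk.injEq] <;>
      exact ⟨key (by decide +kernel), key (by decide +kernel), key (by decide +kernel),
        key (by decide +kernel), key (by decide +kernel)⟩
  · have hne : ∀ j : Fin 5, tetrad (z (representative j)) ≠ 5 := by
      intro j h
      have h5 := z.injective (apply_eq_of_mem_fixFour hhi hz _ h)
      have hr : ∀ j, tetrad (representative j) ≠ 5 := by decide
      exact hr j (h5 ▸ h)
    have hinj : Function.Injective fun j : Fin 5 =>
        (tetrad (z (representative j))).castPred (hne j) := by
      intro j j' h
      have h2 := htet (inv_mem hz) (Fin.castPred_inj.1 h)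
      have hz1 : ∀ x, z⁻¹ (z x) = x := z.symm_apply_apply
      rw [hz1, hz1] at h2
      have hr : ∀ j j', tetrad (representative j) = tetrad (representative j') → j = j' := by
        decide
      exact hr j j' h2
    have h := walkProb_coloringWalk
      (Equiv.ofBijective _ (Finite.injective_iff_bijective.1 hinj))
    simp only [Equiv.ofBijective_apply, Fin.castSucc_castPred] at h
    exact h

theorem mixableTransitive_four (hlo : design.aut ⊓ stabilizer _ (23 : Fin 24) ≤ G)
    (hhi : G ≤ design.autThrough 23) : MixableTransitive (fixFour G) {2, 1, 0, 23} := by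
  have hF : ∀ x, x ∈ ({2, 1, 0, 23} : Set (Fin 24)) ↔ tetrad x = 5 := by
    simp only [Set.mem_insert_iff, Set.mem_singleton_iff]
    decide
  have hreach : ∀ y ∉ ({2, 1, 0, 23} : Set (Fin 24)), ∃ σ ∈ fixFour G, σ 9 = y := by
    intro y hy
    rw [hF] at hy
    -- The translations are transitive on the tetrad of 9, the involutions permute the tetrads.
    have : ∀ y, tetrad y ≠ 5 → ∃ (a b : Fin 2) (i j : Fin 4) (c d : Fin 2),
        (tetradInvolution i ^ (c : ℕ) * tetradInvolution j ^ (d : ℕ) *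
          (tetradTranslation 0 ^ (a : ℕ) * tetradTranslation 1 ^ (b : ℕ))) 9 = y := by
      decide +kernel
    obtain ⟨a, b, i, j, c, d, h⟩ := this y hy
    have hI := tetradInvolution_mem_fixFour hlo
    have hT := tetradTranslation_mem_fixFour hlo
    exact ⟨_, mul_mem (mul_mem (pow_mem (hI i) _) (pow_mem (hI j) _))
      (mul_mem (pow_mem (hT 0) _) (pow_mem (hT 1) _)), h⟩
  refine ⟨isMixable_fixFour hlo hhi, fun σ hσ x hx => ?_, fun x hx y hy => ?_⟩
  · exact apply_eq_of_mem_fixFour hhi hσ x ((hF x).1 hx)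
  · obtain ⟨σ, hσ, rfl⟩ := hreach x hx
    obtain ⟨τ, hτ, rfl⟩ := hreach y hy
    exact ⟨τ * σ⁻¹, mul_mem hτ (inv_mem hσ), by simp⟩

/-! ### From `M₂₂` to `M₂₄` -/

theorem mixableTransitive_two (hlo : design.aut ⊓ stabilizer _ (23 : Fin 24) ≤ G)
    (hhi : G ≤ design.autThrough 23) :
    MixableTransitive (G ⊓ stabilizer _ (0 : Fin 24)) {0, 23} := by
  have h3 : MixableTransitive (G ⊓ stabilizer _ (0 : Fin 24) ⊓ stabilizer _ (1 : Fin 24))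
      {1, 0, 23} := by
    refine (mixableTransitive_four hlo hhi).of_stabilizer ?_ ?_
    · rintro σ ⟨⟨hG, h0⟩, h1⟩ x (rfl | rfl | rfl)
      exacts [h1, h0, (hhi hG).1]
    · refine ⟨permOfCycles [[2, 3], [6, 18], [9, 21], [10, 12], [11, 13], [14, 17], [16, 19],
        [20, 22]], ⟨⟨hlo ⟨?_, ?_⟩, ?_⟩, ?_⟩, ?_⟩
      · exact mem_aut_of_preservesCode (by decide +kernel)
      exacts [mem_stabilizer_iff.2 (by decide), mem_stabilizer_iff.2 (by decide),
        mem_stabilizer_iff.2 (by decide), by decide]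
  refine h3.of_stabilizer ?_ ?_
  · rintro σ ⟨hG, h0⟩ x (rfl | rfl)
    exacts [h0, (hhi hG).1]
  · refine ⟨permOfCycles [[1, 2], [6, 15], [7, 10], [8, 11], [9, 19], [14, 17], [16, 22],
      [20, 21]], ⟨hlo ⟨?_, ?_⟩, ?_⟩, ?_⟩
    · exact mem_aut_of_preservesCode (by decide +kernel)
    exacts [mem_stabilizer_iff.2 (by decide), mem_stabilizer_iff.2 (by decide), by decide]

/-- Both `M₂₃` and the stabilizer of `∞` in `M₂₄` qualify for `G`. -/
theorem mixableTransitive_one (hlo : design.aut ⊓ stabilizer _ (23 : Fin 24) ≤ G)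
    (hhi : G ≤ design.autThrough 23) : MixableTransitive G {23} := by
  refine (mixableTransitive_two hlo hhi).of_stabilizer ?_ ?_
  · rintro σ hG x rfl
    exact (hhi hG).1
  · refine ⟨permOfCycles [[0, 1], [6, 21], [8, 15], [9, 18], [10, 12], [11, 20], [13, 22],
      [14, 17]], hlo ⟨?_, ?_⟩, ?_⟩
    · exact mem_aut_of_preservesCode (by decide +kernel)
    exacts [mem_stabilizer_iff.2 (by decide), by decide]

theorem isMixable_aut : IsMixable design.aut := by
  have h := mixableTransitive_one le_rfl (design.aut_inf_stabilizer_le_autThrough 23)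
  refine (MixableTransitive.of_stabilizer (F := ∅) (x := 23) (by simpa using h) (by simp)
    ⟨permOfCycles [[0, 23], [6, 10], [7, 15], [9, 21], [12, 18], [14, 17], [16, 22], [19, 20]],
      ?_, ?_⟩).isMixable
  · exact mem_aut_of_preservesCode (by decide +kernel)
  · decide

/-- The embedding of `M₂₃` into the permutations of the points `0, …, 23`. -/
def mathieu23Hom : mathieu23 →* Equiv.Perm (Fin 24) :=
  pt.symm.permCongrHom.toMonoidHom.comp (Equiv.Perm.ofSubtype.comp mathieu23.subtype)

theorem mathieu23Hom_injective : Function.Injective mathieu23Hom :=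
  pt.symm.permCongrHom.injective.comp
    (Equiv.Perm.ofSubtype_injective.comp mathieu23.subtype_injective)

theorem range_mathieu23Hom : mathieu23Hom.range = design.autThrough 23 := by
  rw [mathieu23Hom, MonoidHom.range_comp, mathieu23, SteinerSystem.range_derived_aut,
    SteinerSystem.map_autThrough]
  rfl

theorem map_mathieu22 :
    mathieu22.map mathieu23Hom = design.autThrough 23 ⊓ stabilizer _ (0 : Fin 24) := by
  have h : ∀ σ : mathieu23, σ ∈ mathieu22 ↔ mathieu23Hom σ 0 = 0 := by
    intro σ
    have h1 : mathieu23Hom σ 0 = pt.symm (Equiv.Perm.ofSubtype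
        (σ : Equiv.Perm {x : Option (ZMod 23) // x ≠ none}) (some 0)) := rfl
    have h2 := Equiv.Perm.ofSubtype_apply_coe
      (σ : Equiv.Perm {x : Option (ZMod 23) // x ≠ none}) ⟨some 0, Option.some_ne_none 0⟩
    dsimp only at h2
    rw [h1, h2, Equiv.symm_apply_eq]
    exact Subtype.ext_iff
  ext τ
  rw [← range_mathieu23Hom]
  constructor
  · rintro ⟨σ, hσ, rfl⟩
    exact ⟨⟨σ, rfl⟩, (h σ).1 hσ⟩
  · rintro ⟨⟨σ, rfl⟩, hσ⟩
    exact ⟨σ, (h σ).2 hσ, rfl⟩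

end Witt24

theorem mixable_mathieu24 : Mixable mathieu24 := by
  refine mixable_of_isMixable_range
    (Witt24.pt.symm.permCongrHom.toMonoidHom.comp mathieu24.subtype)
    (Witt24.pt.symm.permCongrHom.injective.comp mathieu24.subtype_injective) ?_
  rw [MonoidHom.range_comp, Subgroup.range_subtype, mathieu24, SteinerSystem.map_aut]
  exact Witt24.isMixable_aut

theorem mixable_mathieu23 : Mixable mathieu23 := by
  refine mixable_of_isMixable_range Witt24.mathieu23Hom Witt24.mathieu23Hom_injective ?_
  rw [Witt24.range_mathieu23Hom]
  exact (Witt24.mixableTransitive_one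
    (Witt24.design.aut_inf_stabilizer_le_autThrough 23) le_rfl).isMixable

theorem mixable_mathieu22 : Mixable mathieu22 := by
  refine mixable_of_isMixable_range (Witt24.mathieu23Hom.comp mathieu22.subtype)
    (Witt24.mathieu23Hom_injective.comp mathieu22.subtype_injective) ?_
  rw [MonoidHom.range_comp, Subgroup.range_subtype, Witt24.map_mathieu22]
  exact (Witt24.mixableTransitive_two
    (Witt24.design.aut_inf_stabilizer_le_autThrough 23) le_rfl).isMixable

theorem mainTheorem9 :
    Mixable mathieu11 ∧ Mixable mathieu12 ∧ Mixable mathieu22 ∧ Mixable mathieu23 ∧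
      Mixable mathieu24 := by
  exact ⟨mixable_mathieu11, mixable_mathieu12, mixable_mathieu22, mixable_mathieu23,
    mixable_mathieu24⟩
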